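/- Let $\mathfrak X=(X,\{R_i\}_{i=0}^d)$ be a symmetric association scheme of class $d$ on a finite set $X$: the $R_i$ are nonempty symmetric relations partitioning $X\times X$, $R_0$ is the diagonal, and for all $i,j,k$ the number of $z\in X$ with $(x,z)\in R_i$ and $(z,y)\in R_j$ is the same for all $(x,y)\in R_k$. Let $A_i$ be the adjacency matrix of $R_i$, and let $E_0,\dots,E_d$ be an ordering of the primitive idempotents of the Bose–Mesner algebra $\mathbb C[A_0,\dots,A_d]$, that is, a basis of this algebra with $E_0=|X|^{-1}J$ (where $J$ is the all-ones matrix), $\sum_i E_i=I$ and $E_iE_j=\delta_{ij}E_i$. Define $p_i(j)$ and $q_i(j)$ by $A_i=\sum_{j=0}^d p_i(j)E_j$ and $E_i=|X|^{-1}\sum_{j=0}^d q_i(j)A_j$, and put $m_i=q_i(0)$ and $\theta_i^*=q_1(i)$. Suppose that $\mathfrak X$ is $Q$-polynomial with respect to the ordering $\{E_i\}_{i=0}^d$, i.e. for each $i\in\{0,\dots,d\}$ there is a polynomial $v_i^*$ of degree $i$ with $q_i(j)=v_i^*(q_1(j))$ for all $j\in\{0,\dots,d\}$, and that $m_1>2$.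 If there is an odd integer $t$ with $1\le t\le d/2$ and $m_t\neq m_{d-t+1}$, then for every $j\in\{1,\dots,d\}$ the generalized Larman–Rogers–Seidel ratio $$K_j=\prod_{\substack{k=1\\k\ne j}}^d\frac{\theta_0^*-\theta_k^*}{\theta_j^*-\theta_k^*}$$ satisfies $K_j=-p_j(d)$ and is a rational integer. -/

import Mathlib

noncomputable section

/-- A symmetric association scheme of class `d` on the finite set `X`. -/
structure SymmAssocScheme (X : Type*) [Fintype X] (d : ℕ) where
  /-- The relations `R_0, …, R_d`. -/
  R : Fin (d + 1) → Set (X × X)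
  nonempty : ∀ i, (R i).Nonempty
  zero_eq : R 0 = {a | a.1 = a.2}
  cover : ⋃ i, R i = Set.univ
  disjoint : ∀ i j, i ≠ j → Disjoint (R i) (R j)
  symm : ∀ i x y, (x, y) ∈ R i → (y, x) ∈ R i
  /-- Existence of the intersection numbers `p_{ij}^k`. -/
  regular : ∀ i j k, ∃ n : ℕ, ∀ x y, (x, y) ∈ R k →
    {z : X | (x, z) ∈ R i ∧ (z, y) ∈ R j}.ncard = n

namespace SymmAssocScheme

variable {X : Type*} [Fintype X] {d : ℕ}

open Classical in
/-- The `i`-th adjacency matrix. -/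
def A (S : SymmAssocScheme X d) (i : Fin (d + 1)) : Matrix X X ℂ :=
  Matrix.of fun x y => if (x, y) ∈ S.R i then 1 else 0

theorem exists_mem (S : SymmAssocScheme X d) (x y : X) : ∃ k, (x, y) ∈ S.R k := by
  have h : (x, y) ∈ ⋃ i, S.R i := by rw [S.cover]; trivial
  simpa using h

theorem A_apply (S : SymmAssocScheme X d) {i k : Fin (d + 1)} {x y : X}
    (h : (x, y) ∈ S.R k) : S.A i x y = if i = k then 1 else 0 := by
  unfold A
  rw [Matrix.of_apply]
  by_cases hik : i = k
  · subst hik; simp [h]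
  · have : (x, y) ∉ S.R i := fun h' => Set.disjoint_left.mp (S.disjoint i k hik) h' h
    simp [this, hik]

theorem sum_A_apply (S : SymmAssocScheme X d) (g : Fin (d + 1) → ℂ) {k : Fin (d + 1)} {x y : X}
    (h : (x, y) ∈ S.R k) : (∑ i, g i • S.A i) x y = g k := by
  simp [Matrix.sum_apply, S.A_apply h]

theorem linearIndependent_A (S : SymmAssocScheme X d) : LinearIndependent ℂ S.A := by
  rw [Fintype.linearIndependent_iff]
  intro g hg k
  obtain ⟨⟨x, y⟩, h⟩ := S.nonempty k
  rw [← S.sum_A_apply g h, hg, Matrix.zero_apply]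

theorem A_mul_A_mem (S : SymmAssocScheme X d) (i j : Fin (d + 1)) :
    S.A i * S.A j ∈ Submodule.span ℂ (Set.range S.A) := by
  classical
  choose n hn using S.regular i j
  have : S.A i * S.A j = ∑ k, (n k : ℂ) • S.A k := by
    ext x y
    obtain ⟨k, hk⟩ := S.exists_mem x y
    rw [S.sum_A_apply _ hk, ← hn k x y hk, Matrix.mul_apply, Set.ncard_eq_toFinset_card']
    simp only [A, Matrix.of_apply, Set.toFinset_ofFinset, ← ite_and, mul_ite, mul_one, mul_zero]
    rw [Finset.sum_boole]
    congr 2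
    ext z
    simp [and_comm]
  rw [this]
  exact Submodule.sum_mem _ fun k _ => Submodule.smul_mem _ _ (Submodule.subset_span ⟨k, rfl⟩)

variable [DecidableEq X]

/-- The Bose–Mesner algebra: the complex algebra generated by the adjacency matrices. -/
def boseMesner (S : SymmAssocScheme X d) : Subalgebra ℂ (Matrix X X ℂ) :=
  Algebra.adjoin ℂ (Set.range S.A)

theorem A_mem (S : SymmAssocScheme X d) (i : Fin (d + 1)) : S.A i ∈ S.boseMesner :=
  Algebra.subset_adjoin ⟨i, rfl⟩

theorem A_zero (S : SymmAssocScheme X d) : S.A 0 = 1 := by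
  ext x y
  by_cases h : x = y <;> simp [A, S.zero_eq, Matrix.one_apply, h]

/-- The adjacency matrices span the Bose–Mesner algebra. -/
theorem span_A (S : SymmAssocScheme X d) :
    Submodule.span ℂ (Set.range S.A) = Subalgebra.toSubmodule S.boseMesner := by
  apply le_antisymm
  · rw [Submodule.span_le]
    rintro _ ⟨i, rfl⟩
    exact S.A_mem i
  · intro M hM
    have hM' : M ∈ Algebra.adjoin ℂ (Set.range S.A) := hM
    induction hM' using Algebra.adjoin_induction with
    | mem x hx => exact Submodule.subset_span hx
    | algebraMap r =>
      rw [Algebra.algebraMap_eq_smul_one, ← S.A_zero]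
      exact Submodule.smul_mem _ _ (Submodule.subset_span ⟨0, rfl⟩)
    | add x y hx hy ihx ihy => exact Submodule.add_mem _ (ihx hx) (ihy hy)
    | mul x y hx hy ihx ihy =>
      have h := Submodule.mul_mem_mul (ihx hx) (ihy hy)
      rw [Submodule.span_mul_span] at h
      refine Submodule.span_le.mpr ?_ h
      rintro _ ⟨_, ⟨i, rfl⟩, _, ⟨j, rfl⟩, rfl⟩
      exact S.A_mul_A_mem i j

/-- An ordering `E_0, …, E_d` of the primitive idempotents of the scheme, that is, a basis of the
Bose–Mesner algebra with `E_0 = |X|⁻¹ J`, `∑ E_i = I` and `E_i E_j = δ_{ij} E_i`. -/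
structure PrimitiveIdempotents (S : SymmAssocScheme X d) where
  E : Fin (d + 1) → Matrix X X ℂ
  linearIndependent : LinearIndependent ℂ E
  span_eq : Submodule.span ℂ (Set.range E) = Subalgebra.toSubmodule S.boseMesner
  zero_eq : E 0 = (Fintype.card X : ℂ)⁻¹ • Matrix.of fun _ _ => 1
  sum_eq : ∑ i, E i = 1
  mul_eq : ∀ i j, E i * E j = if i = j then E i else 0

namespace PrimitiveIdempotents

variable {S : SymmAssocScheme X d} (B : S.PrimitiveIdempotents)

theorem A_mem_span (i : Fin (d + 1)) : S.A i ∈ Submodule.span ℂ (Set.range B.E) := by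
  rw [B.span_eq]; exact S.A_mem i

theorem E_mem_span (i : Fin (d + 1)) : B.E i ∈ Submodule.span ℂ (Set.range S.A) := by
  rw [S.span_A, ← B.span_eq]; exact Submodule.subset_span ⟨i, rfl⟩

/-- `p_i(j)`: the coefficient of `E_j` in `A_i = ∑ j, p_i(j) E_j`. -/
def p (i j : Fin (d + 1)) : ℂ :=
  B.linearIndependent.repr ⟨S.A i, B.A_mem_span i⟩ j

/-- `q_i(j)`: `|X|` times the coefficient of `A_j` in `E_i`, so `E_i = |X|⁻¹ ∑ j, q_i(j) A_j`. -/
def q (i j : Fin (d + 1)) : ℂ :=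
  (Fintype.card X : ℂ) * S.linearIndependent_A.repr ⟨B.E i, B.E_mem_span i⟩ j

theorem A_eq_sum (i : Fin (d + 1)) : S.A i = ∑ j, B.p i j • B.E j := by
  have h := B.linearIndependent.linearCombination_repr ⟨S.A i, B.A_mem_span i⟩
  rw [Finsupp.linearCombination_apply, Finsupp.sum_fintype _ _ (by simp)] at h
  exact h.symm

theorem E_eq_sum (i : Fin (d + 1)) :
    B.E i = (Fintype.card X : ℂ)⁻¹ • ∑ j, B.q i j • S.A j := by
  have hX : (Fintype.card X : ℂ) ≠ 0 := by
    obtain ⟨⟨x, _⟩, _⟩ := S.nonempty 0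
    have : Nonempty X := ⟨x⟩
    exact_mod_cast Fintype.card_ne_zero
  have h := S.linearIndependent_A.linearCombination_repr ⟨B.E i, B.E_mem_span i⟩
  rw [Finsupp.linearCombination_apply, Finsupp.sum_fintype _ _ (by simp)] at h
  simp only [q, mul_smul, ← Finset.smul_sum]
  rw [inv_smul_smul₀ hX]
  exact h.symm

/-- The multiplicity `m_i = q_i(0)`. -/
def m (i : Fin (d + 1)) : ℂ := B.q i 0

/-- The dual eigenvalue `θ*_i = q_1(i)`. -/
def dualEigenvalue (i : Fin (d + 1)) : ℂ := B.q 1 i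

/-- The scheme is `Q`-polynomial with respect to the ordering `E_0, …, E_d`. -/
def IsQPolynomial : Prop :=
  ∀ i : Fin (d + 1), ∃ v : Polynomial ℂ, v.degree = ((i : ℕ) : WithBot ℕ) ∧
    ∀ j, B.q i j = v.eval (B.q 1 j)

/-- The generalized Larman–Rogers–Seidel ratio
`K_i = ∏_{1 ≤ j ≤ d, j ≠ i} (θ*_0 - θ*_j) / (θ*_i - θ*_j)` (for `1 ≤ i ≤ d`). -/
def K (i : Fin (d + 1)) : ℂ :=
  ∏ j ∈ Finset.univ.filter (fun j : Fin (d + 1) => j ≠ 0 ∧ j ≠ i),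
    (B.dualEigenvalue 0 - B.dualEigenvalue j) / (B.dualEigenvalue i - B.dualEigenvalue j)

end PrimitiveIdempotents

end SymmAssocScheme

end

/-!
Every field automorphism `σ` of `ℂ` fixes the adjacency matrices, hence permutes the idempotents
`E_i` and preserves the set of vanishing Krein parameters `q_{ij}^k`. Since `p_j(d)` is an algebraic
integer, it is a rational integer as soon as every `σ` fixes `E_d`.

Ordering the indices along the path whose edges are the pairs with `q_{1i}^j ≠ 0`, the permutation
turns into one path structure laid over another, constrained by the triangle inequality for the
indices of a nonvanishing Krein parameter. A few more vanishing conditions come from computing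
`E_i D(x) D(y) E_k` in two ways, where `D(x)` is the commuting family of diagonal matrices carrying
the rows of `E_1`; here `m_1 ≠ 2` enters. The outcome is that `σ` either fixes `E_d` or sends `E_t`
to `E_{d+1-t}` for each odd `t ≤ d/2`, and then `m_t = m_{d-t+1}` because `σ` preserves traces.

Finally, apply the polynomial of degree `d - 1` with roots `θ*_k`, `k ≠ 0, j`, to the entries of
`|X| E_1`. The result is a combination of `A_0` and `A_j` by the choice of roots, and is annihilated
by `E_d` by its degree. Comparing coefficients gives `K_j = -p_j(d)`.
-/

open Finset Matrix
open scoped ComplexOrder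

theorem trace_eq_rank_of_isIdempotentElem {n K : Type*} [Fintype n] [Field K]
    {M : Matrix n n K} (hM : IsIdempotentElem M) : M.trace = (M.rank : K) := by
  classical
  have hM' : IsIdempotentElem M.toLin' := hM.map (Matrix.toLinAlgEquiv' (R := K) (n := n))
  rw [← Matrix.trace_toLin'_eq, (LinearMap.IsIdempotentElem.isProj_range _ hM').trace,
    Matrix.rank, Matrix.toLin'_apply']

theorem exists_perm_of_orthogonalIdempotents {ι K R : Type*} [Finite ι] [Field K] [Ring R]
    [Algebra K R] {e f : ι → R} (he : OrthogonalIdempotents e) (hf : OrthogonalIdempotents f)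
    (hf₀ : ∀ i, f i ≠ 0) (hfe : ∀ i, f i ∈ Submodule.span K (Set.range e)) :
    ∃ π : Equiv.Perm ι, ∀ i, f i = e (π i) := by
  classical
  cases nonempty_fintype ι
  choose c hc using fun i => (Submodule.mem_span_range_iff_exists_fun K).mp (hfe i)
  have mul_e : ∀ i k, f i * e k = c i k • e k := by
    simp [← hc, sum_mul, he.mul_eq]
  have sum_mul_e : ∀ i, ∑ k, f i * e k = f i := by
    simp [mul_e, hc]
  have exists_fixed : ∀ i, ∃ k, e k ≠ 0 ∧ f i * e k = e k := by
    intro i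
    obtain ⟨k, -, hk⟩ := exists_ne_zero_of_sum_ne_zero ((sum_mul_e i).symm ▸ hf₀ i)
    have hc₀ : c i k ≠ 0 := fun h => hk (by rw [mul_e, h, zero_smul])
    refine ⟨k, right_ne_zero_of_mul hk, smul_right_injective R hc₀ ?_⟩
    simp only
    rw [← mul_smul_comm, ← mul_e, ← mul_assoc, (hf.idem i).eq]
  choose π hπ₀ hπ using exists_fixed
  have mul_e_of_ne : ∀ {i j}, i ≠ j → f i * e (π j) = 0 := fun {i j} hij => by
    rw [← hπ j, ← mul_assoc, hf.ortho hij, zero_mul]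
  have π_injective : Function.Injective π := fun i j hij => by
    by_contra hne
    exact hπ₀ i (by rw [← hπ i, hij, mul_e_of_ne hne])
  have π_bijective := Finite.injective_iff_bijective.mp π_injective
  refine ⟨Equiv.ofBijective π π_bijective, fun i => ?_⟩
  rw [← sum_mul_e i, ← π_bijective.sum_comp, sum_eq_single i]
  · exact hπ i
  · exact fun j _ hj => mul_e_of_ne hj.symm
  · simp

theorem isIntegral_of_mul_eq_smul {R K A : Type*} [CommRing R] [Field K] [Ring A] [Algebra R K]
    [Algebra K A] [Algebra R A] [IsScalarTower R K A] {a b : A} {μ : K} (ha : IsIntegral R a)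
    (hb : b ≠ 0) (hab : a * b = μ • b) : IsIntegral R μ := by
  obtain ⟨f, hf, hfa⟩ := ha
  refine ⟨f, hf, ?_⟩
  have heig : (Algebra.lmul K A a).HasEigenvector μ b :=
    ⟨Module.End.mem_eigenspace_iff.mpr hab, hb⟩
  have h := Module.End.aeval_apply_of_hasEigenvector heig (p := f.map (algebraMap R K))
  rw [Polynomial.aeval_algHom_apply, Polynomial.aeval_map_algebraMap, Polynomial.aeval_def, hfa,
    map_zero, LinearMap.zero_apply, Polynomial.eval_map] at h
  exact (smul_eq_zero.mp h.symm).resolve_right hb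

theorem exists_ringEquiv_extending {L Ω : Type*} [Field L] [Field Ω] [IsAlgClosed Ω]
    [Algebra L Ω] (τ : L ≃+* L) :
    ∃ σ : Ω ≃+* Ω, ∀ x, σ (algebraMap L Ω x) = algebraMap L Ω (τ x) := by
  obtain ⟨s, hs⟩ := exists_isTranscendenceBasis L Ω
  have := IsAlgClosed.isAlgClosure_of_transcendence_basis _ hs
  -- `τ` acts on the coefficients of the polynomial ring on a transcendence basis.
  let φ := (hs.1.aevalEquiv (A := Ω)).toRingEquiv
  let e := (φ.symm.trans (MvPolynomial.mapEquiv s τ)).trans φ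
  have he : ∀ x, e (algebraMap L _ x) = algebraMap L _ (τ x) := fun x => by
    simp [e, φ, MvPolynomial.algebraMap_eq, ← (hs.1.aevalEquiv (A := Ω)).commutes]
  refine ⟨IsAlgClosure.equivOfEquiv Ω Ω e, fun x => ?_⟩
  rw [IsScalarTower.algebraMap_apply L (Algebra.adjoin L (Set.range ((↑) : s → Ω))) Ω,
    IsAlgClosure.equivOfEquiv_algebraMap, he, ← IsScalarTower.algebraMap_apply]

theorem exists_intCast_eq_of_isIntegral {Ω : Type*} [Field Ω] [CharZero Ω] [IsAlgClosed Ω] {z : Ω}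
    (hz : IsIntegral ℤ z) (hfix : ∀ σ : Ω ≃+* Ω, σ z = z) : ∃ n : ℤ, (n : Ω) = z := by
  let L := algebraicClosure ℚ Ω
  have : IsAlgClosure ℚ L := algebraicClosure.isAlgClosure ℚ Ω
  have : IsGalois ℚ L := IsAlgClosure.isGalois ℚ L
  let w : L := ⟨z, mem_algebraicClosure_iff.mpr (hz.tower_top (A := ℚ)).isAlgebraic⟩
  have hw : w ∈ (⊥ : IntermediateField ℚ L) := by
    rw [InfiniteGalois.mem_bot_iff_fixed]
    intro τ
    obtain ⟨σ, hσ⟩ := exists_ringEquiv_extending (Ω := Ω) τ.toRingEquiv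
    exact Subtype.ext ((hσ w).symm.trans (hfix σ))
  obtain ⟨r, hr⟩ := IntermediateField.mem_bot.mp hw
  have hrz : algebraMap ℚ Ω r = z := by
    rw [IsScalarTower.algebraMap_apply ℚ L Ω, hr]; rfl
  have hr_int : IsIntegral ℤ r :=
    (isIntegral_algebraMap_iff (algebraMap ℚ Ω).injective).mp (hrz ▸ hz)
  obtain ⟨n, rfl⟩ := IsIntegrallyClosed.isIntegral_iff.mp hr_int
  exact ⟨n, by simpa using hrz⟩

theorem degree_sub_smul_lt {K : Type*} [Field K] {f v : Polynomial K} {r : ℕ} (hv : v.degree = r)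
    (hf : f.degree ≤ r) : (f - (f.coeff r / v.coeff r) • v).degree < r := by
  rw [Polynomial.degree_lt_iff_coeff_zero]
  intro k hk
  rw [Polynomial.coeff_sub, Polynomial.coeff_smul, smul_eq_mul]
  rcases hk.eq_or_lt with rfl | hk
  · rw [div_mul_cancel₀ _ (Polynomial.coeff_ne_zero_of_eq_degree hv), sub_self]
  · have hk' : (r : WithBot ℕ) < k := Nat.cast_lt.mpr hk
    rw [Polynomial.coeff_eq_zero_of_degree_lt (hf.trans_lt hk'),
      Polynomial.coeff_eq_zero_of_degree_lt (hv.trans_lt hk'), mul_zero, sub_zero]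

namespace SymmAssocScheme

variable {X : Type*} [Fintype X] {d : ℕ}

theorem card_ne_zero (S : SymmAssocScheme X d) : (Fintype.card X : ℂ) ≠ 0 := by
  obtain ⟨⟨x, _⟩, _⟩ := S.nonempty 0
  exact_mod_cast (Fintype.card_pos_iff.mpr ⟨x⟩).ne'

variable (S : SymmAssocScheme X d)

theorem A_transpose (i : Fin (d + 1)) : (S.A i)ᵀ = S.A i := by
  ext x y
  simp only [A, transpose_apply, Matrix.of_apply]
  congr 1
  exact propext ⟨S.symm i y x, S.symm i x y⟩

theorem A_map (σ : ℂ →+* ℂ) (i : Fin (d + 1)) : (S.A i).map σ = S.A i := by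
  ext x y
  simp [A, apply_ite σ]

variable [DecidableEq X]

theorem isIntegral_A (i : Fin (d + 1)) : IsIntegral ℤ (S.A i) := by
  classical
  let N : Matrix X X ℤ := Matrix.of fun x y => if (x, y) ∈ S.R i then 1 else 0
  have hN : S.A i = (Int.castRingHom ℂ).mapMatrix N := by
    ext x y
    simp [A, N]
  rw [hN]
  exact (Matrix.isIntegral N).map (Int.castRingHom ℂ).mapMatrix.toIntAlgHom

theorem mem_boseMesner_iff {M : Matrix X X ℂ} :
    M ∈ S.boseMesner ↔ ∃ c : Fin (d + 1) → ℂ, ∑ i, c i • S.A i = M := by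
  rw [← Subalgebra.mem_toSubmodule, ← S.span_A, Submodule.mem_span_range_iff_exists_fun]

variable {S}

theorem hadamard_mem {M N : Matrix X X ℂ} (hM : M ∈ S.boseMesner) (hN : N ∈ S.boseMesner) :
    M ⊙ N ∈ S.boseMesner := by
  obtain ⟨a, rfl⟩ := S.mem_boseMesner_iff.mp hM
  obtain ⟨b, rfl⟩ := S.mem_boseMesner_iff.mp hN
  refine S.mem_boseMesner_iff.mpr ⟨fun i => a i * b i, ?_⟩
  ext x y
  obtain ⟨k, hk⟩ := S.exists_mem x y
  simp only [hadamard_apply, S.sum_A_apply _ hk]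

theorem transpose_eq_of_mem {M : Matrix X X ℂ} (hM : M ∈ S.boseMesner) : Mᵀ = M := by
  obtain ⟨c, rfl⟩ := S.mem_boseMesner_iff.mp hM
  simp [transpose_sum, S.A_transpose]

theorem map_mem {M : Matrix X X ℂ} (hM : M ∈ S.boseMesner) (σ : ℂ →+* ℂ) :
    M.map σ ∈ S.boseMesner := by
  obtain ⟨c, rfl⟩ := S.mem_boseMesner_iff.mp hM
  refine S.mem_boseMesner_iff.mpr ⟨fun i => σ (c i), ?_⟩
  ext x y
  obtain ⟨k, hk⟩ := S.exists_mem x y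
  simp only [Matrix.map_apply, S.sum_A_apply _ hk]

namespace PrimitiveIdempotents

variable (B : S.PrimitiveIdempotents)

theorem E_mem (i : Fin (d + 1)) : B.E i ∈ S.boseMesner := by
  rw [← Subalgebra.mem_toSubmodule, ← B.span_eq]
  exact Submodule.subset_span ⟨i, rfl⟩

theorem E_ne_zero (i : Fin (d + 1)) : B.E i ≠ 0 := B.linearIndependent.ne_zero i

theorem orthogonalIdempotents : OrthogonalIdempotents B.E :=
  OrthogonalIdempotents.iff_mul_eq.mpr B.mul_eq

theorem exists_mul_E {M : Matrix X X ℂ} (hM : M ∈ S.boseMesner) (k : Fin (d + 1)) :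
    ∃ c : ℂ, M * B.E k = c • B.E k := by
  rw [← Subalgebra.mem_toSubmodule, ← B.span_eq, Submodule.mem_span_range_iff_exists_fun] at hM
  obtain ⟨c, rfl⟩ := hM
  exact ⟨c k, by simp [sum_mul, B.mul_eq]⟩

theorem A_mul_E (i k : Fin (d + 1)) : S.A i * B.E k = B.p i k • B.E k := by
  rw [B.A_eq_sum i]
  simp [sum_mul, B.mul_eq]

theorem isIntegral_p (i k : Fin (d + 1)) : IsIntegral ℤ (B.p i k) :=
  isIntegral_of_mul_eq_smul (S.isIntegral_A i) (B.E_ne_zero k) (B.A_mul_E i k)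

theorem E_apply {i k : Fin (d + 1)} {x y : X} (h : (x, y) ∈ S.R k) :
    B.E i x y = (Fintype.card X : ℂ)⁻¹ * B.q i k := by
  rw [B.E_eq_sum, Matrix.smul_apply, S.sum_A_apply _ h, smul_eq_mul]

theorem m_eq_trace (i : Fin (d + 1)) : B.m i = (B.E i).trace := by
  have hdiag : ∀ x, B.E i x x = (Fintype.card X : ℂ)⁻¹ * B.m i := fun x =>
    B.E_apply (k := 0) (by simp [S.zero_eq])
  simp [Matrix.trace, hdiag, S.card_ne_zero]

theorem m_eq_rank (i : Fin (d + 1)) : B.m i = ((B.E i).rank : ℂ) := by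
  rw [m_eq_trace, trace_eq_rank_of_isIdempotentElem (B.orthogonalIdempotents.idem i)]

theorem exists_perm_map_E (σ : ℂ →+* ℂ) :
    ∃ π : Equiv.Perm (Fin (d + 1)), ∀ i, (B.E i).map σ = B.E (π i) := by
  have hmap := B.orthogonalIdempotents.map (σ.mapMatrix (m := X))
  have hinj : Function.Injective (σ.mapMatrix (m := X)) := Matrix.map_injective σ.injective
  refine exists_perm_of_orthogonalIdempotents (K := ℂ) B.orthogonalIdempotents hmap (fun i => ?_)
    (fun i => ?_)
  · exact (map_ne_zero_iff _ hinj).mpr (B.E_ne_zero i)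
  · rw [B.span_eq]
    exact S.map_mem (B.E_mem i) σ

/-- The permutation of the primitive idempotents induced by a field endomorphism of `ℂ`. -/
noncomputable def galoisPerm (σ : ℂ →+* ℂ) : Equiv.Perm (Fin (d + 1)) :=
  (B.exists_perm_map_E σ).choose

theorem E_map (σ : ℂ →+* ℂ) (i : Fin (d + 1)) : (B.E i).map σ = B.E (B.galoisPerm σ i) :=
  (B.exists_perm_map_E σ).choose_spec i

theorem galoisPerm_zero (σ : ℂ →+* ℂ) : B.galoisPerm σ 0 = 0 := by
  refine B.linearIndependent.injective ?_
  rw [← E_map, B.zero_eq]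
  ext x y
  simp

theorem m_galoisPerm (σ : ℂ →+* ℂ) (i : Fin (d + 1)) : B.m (B.galoisPerm σ i) = B.m i := by
  have h : ((B.E i).map σ).trace = σ (B.E i).trace := by simp [Matrix.trace]
  rw [m_eq_trace, ← E_map, h, ← m_eq_trace, m_eq_rank, map_natCast]

theorem p_galoisPerm (σ : ℂ →+* ℂ) (i k : Fin (d + 1)) :
    B.p i (B.galoisPerm σ k) = σ (B.p i k) := by
  refine smul_left_injective ℂ (B.E_ne_zero (B.galoisPerm σ k)) ?_
  calc B.p i (B.galoisPerm σ k) • B.E (B.galoisPerm σ k)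
      = (S.A i * B.E k).map σ := by rw [Matrix.map_mul, A_map, E_map, A_mul_E]
    _ = σ (B.p i k) • B.E (B.galoisPerm σ k) := by
      rw [A_mul_E, Matrix.map_smul' _ _ _ (map_mul σ), E_map]

theorem E_conjTranspose (i : Fin (d + 1)) : (B.E i)ᴴ = B.E i := by
  have hE : (B.E i)ᴴ = B.E (B.galoisPerm (starRingEnd ℂ) i) := by
    rw [← E_map, conjTranspose, S.transpose_eq_of_mem (B.E_mem i)]
    rfl
  suffices h : B.galoisPerm (starRingEnd ℂ) i = i by rw [hE, h]
  by_contra hne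
  refine B.E_ne_zero i (conjTranspose_mul_self_eq_zero.mp ?_)
  rw [hE, B.mul_eq, if_neg hne]

theorem m_ne_zero (i : Fin (d + 1)) : B.m i ≠ 0 := by
  have h : B.m i = ((B.E i)ᴴ * B.E i).trace := by
    rw [m_eq_trace, E_conjTranspose, B.mul_eq, if_pos rfl]
  rw [h, ne_eq, trace_conjTranspose_mul_self_eq_zero_iff]
  exact B.E_ne_zero i

/-- The primitive idempotents indexed by `ℕ`, with value zero beyond `d`; the vanishing conditions
on the Krein parameters thereby need no range restriction on the indices. -/
noncomputable def idem (i : ℕ) : Matrix X X ℂ := if h : i < d + 1 then B.E ⟨i, h⟩ else 0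

theorem idem_val (i : Fin (d + 1)) : B.idem i = B.E i := dif_pos i.2

theorem idem_of_lt {i : ℕ} (h : d < i) : B.idem i = 0 := dif_neg (by omega)

variable {B} in
theorem idem_cases {P : ℕ → Matrix X X ℂ → Prop} (val : ∀ i : Fin (d + 1), P i (B.E i))
    (zero : ∀ i > d, P i 0) (i : ℕ) : P i (B.idem i) := by
  rcases le_or_gt i d with h | h
  · simpa only [← B.idem_val] using val ⟨i, Nat.lt_succ_of_le h⟩
  · simpa only [B.idem_of_lt h] using zero i h

theorem idem_mem (i : ℕ) : B.idem i ∈ S.boseMesner :=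
  idem_cases (P := fun _ M => M ∈ S.boseMesner) B.E_mem (fun _ _ => zero_mem _) i

theorem idem_transpose (i : ℕ) : (B.idem i)ᵀ = B.idem i := S.transpose_eq_of_mem (B.idem_mem i)

theorem idem_comm (i : ℕ) (x y : X) : B.idem i x y = B.idem i y x :=
  congrFun₂ (B.idem_transpose i).symm x y

theorem idem_conjTranspose (i : ℕ) : (B.idem i)ᴴ = B.idem i :=
  idem_cases (P := fun _ M => Mᴴ = M) B.E_conjTranspose (fun _ _ => conjTranspose_zero) i

theorem star_idem_apply (i : ℕ) (x y : X) : star (B.idem i x y) = B.idem i x y := by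
  rw [← conjTranspose_apply, B.idem_conjTranspose, B.idem_comm]

theorem idem_ne_zero {i : ℕ} (h : i ≤ d) : B.idem i ≠ 0 :=
  B.idem_val ⟨i, Nat.lt_succ_of_le h⟩ ▸ B.E_ne_zero _

theorem trace_idem_ne_zero {i : ℕ} (h : i ≤ d) : (B.idem i).trace ≠ 0 :=
  B.idem_val ⟨i, Nat.lt_succ_of_le h⟩ ▸ B.m_eq_trace _ ▸ B.m_ne_zero _

theorem idem_mul_self (i : ℕ) : B.idem i * B.idem i = B.idem i :=
  idem_cases (P := fun _ M => M * M = M) (fun i => B.orthogonalIdempotents.idem i)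
    (fun _ _ => mul_zero 0) i

theorem idem_mul_of_ne {i j : ℕ} (hij : i ≠ j) : B.idem i * B.idem j = 0 := by
  revert hij
  refine idem_cases (P := fun i M => i ≠ j → M * B.idem j = 0) (fun i => ?_) (by simp) i
  refine idem_cases (P := fun j M => (i : ℕ) ≠ j → B.E i * M = 0) (fun j hij => ?_) (by simp) j
  exact B.orthogonalIdempotents.ortho (fun h => hij (congrArg Fin.val h))

theorem sum_idem : ∑ i ∈ range (d + 1), B.idem i = 1 := by
  simp only [sum_range, idem_val, B.sum_eq]

theorem mul_idem_of_mem {M : Matrix X X ℂ} (hM : M ∈ S.boseMesner) (k : ℕ) :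
    M * B.idem k = ((M * B.idem k).trace / (B.idem k).trace) • B.idem k := by
  rcases le_or_gt k d with hk | hk
  · obtain ⟨c, hc⟩ := B.exists_mul_E hM ⟨k, Nat.lt_succ_of_le hk⟩
    rw [← idem_val] at hc
    rw [hc, trace_smul, smul_eq_mul, mul_div_cancel_right₀ _ (B.trace_idem_ne_zero hk)]
  · simp [B.idem_of_lt hk]

/-- The permutation of `ℕ` that extends `galoisPerm` by the identity beyond `d`, so that it acts on
the idempotents `idem i`. -/
noncomputable def galoisPermNat (σ : ℂ →+* ℂ) : Equiv.Perm ℕ :=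
  (B.galoisPerm σ).extendDomain Fin.equivSubtype

theorem galoisPermNat_val (σ : ℂ →+* ℂ) (i : Fin (d + 1)) :
    B.galoisPermNat σ i = B.galoisPerm σ i :=
  Equiv.Perm.extendDomain_apply_image _ Fin.equivSubtype i

theorem idem_map (σ : ℂ →+* ℂ) (i : ℕ) : (B.idem i).map σ = B.idem (B.galoisPermNat σ i) := by
  refine idem_cases (P := fun i M => M.map σ = B.idem (B.galoisPermNat σ i)) (fun i => ?_)
    (fun i hi => ?_) i
  · rw [galoisPermNat_val, idem_val, E_map]
  · have hfix : B.galoisPermNat σ i = i :=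
      Equiv.Perm.extendDomain_apply_not_subtype _ _ (by omega)
    rw [hfix, B.idem_of_lt hi, Matrix.map_zero _ (map_zero σ)]

/-- The sum of the entries of `E_i ∘ E_j ∘ E_k`. It equals `m_k q_{ij}^k / |X|` for the Krein
parameter `q_{ij}^k`, so it has the same zeros but is symmetric in all three indices. -/
noncomputable def kreinSum (i j k : ℕ) : ℂ := ∑ x, ∑ y, (B.idem i ⊙ B.idem j ⊙ B.idem k) x y

theorem kreinSum_swap (i j k : ℕ) : B.kreinSum i j k = B.kreinSum j i k := by
  simp only [kreinSum, hadamard_comm (B.idem i)]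

theorem kreinSum_rotate (i j k : ℕ) : B.kreinSum i j k = B.kreinSum k i j := by
  simp only [kreinSum, hadamard_comm _ (B.idem k), hadamard_assoc]

theorem kreinSum_eq_zero_of_lt {i : ℕ} (h : d < i) (j k : ℕ) : B.kreinSum i j k = 0 := by
  simp [kreinSum, B.idem_of_lt h]

theorem kreinSum_eq_trace (i j k : ℕ) :
    B.kreinSum i j k = ((B.idem i ⊙ B.idem j) * B.idem k).trace := by
  rw [kreinSum, sum_hadamard_eq, idem_transpose]

theorem kreinSum_galoisPermNat (σ : ℂ →+* ℂ) (i j k : ℕ) :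
    B.kreinSum (B.galoisPermNat σ i) (B.galoisPermNat σ j) (B.galoisPermNat σ k) =
      σ (B.kreinSum i j k) := by
  simp [kreinSum, ← idem_map]

/-- The eigenvalue of `E_i ∘ E_j` on `E_k`, that is, the Krein parameter `q_{ij}^k` divided by
`|X|` (and `0` when an index exceeds `d`). -/
noncomputable def kreinCoeff (i j k : ℕ) : ℂ := B.kreinSum i j k / (B.idem k).trace

theorem kreinCoeff_eq_zero_iff {i j k : ℕ} : B.kreinCoeff i j k = 0 ↔ B.kreinSum i j k = 0 := by
  rcases le_or_gt k d with hk | hk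
  · simp [kreinCoeff, B.trace_idem_ne_zero hk]
  · simp [kreinCoeff, B.kreinSum_rotate i, B.kreinSum_eq_zero_of_lt hk]

theorem hadamard_mul_idem (i j k : ℕ) :
    (B.idem i ⊙ B.idem j) * B.idem k = B.kreinCoeff i j k • B.idem k := by
  rw [kreinCoeff, kreinSum_eq_trace]
  exact B.mul_idem_of_mem (hadamard_mem (B.idem_mem i) (B.idem_mem j)) k

/-- The diagonal matrix carrying the row `x` of `E_j`: the `j`-th dual adjacency matrix with base
vertex `x`, divided by `|X|`. -/
noncomputable def dualAdj (j : ℕ) (x : X) : Matrix X X ℂ := diagonal (B.idem j x)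

theorem dualAdj_transpose (j : ℕ) (x : X) : (B.dualAdj j x)ᵀ = B.dualAdj j x :=
  diagonal_transpose _

theorem dualAdj_conjTranspose (j : ℕ) (x : X) : (B.dualAdj j x)ᴴ = B.dualAdj j x := by
  rw [dualAdj, diagonal_conjTranspose]
  exact congrArg diagonal (funext (B.star_idem_apply j x))

theorem dualAdj_commute (i j : ℕ) (x y : X) : Commute (B.dualAdj i x) (B.dualAdj j y) :=
  commute_diagonal _ _

theorem dualAdj_zero (x : X) : B.dualAdj 0 x = (Fintype.card X : ℂ)⁻¹ • 1 := by
  have h : B.idem 0 = B.E 0 := B.idem_val 0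
  rw [smul_one_eq_diagonal, dualAdj, h, B.zero_eq]
  congr 1
  ext
  simp

theorem sum_smul_dualAdj (j : ℕ) (x : X) : ∑ z, B.idem j x z • B.dualAdj j z = B.dualAdj j x := by
  ext a b
  rcases eq_or_ne a b with rfl | hab
  · conv_rhs => rw [dualAdj, diagonal_apply_eq, ← idem_mul_self]
    simp [dualAdj, Matrix.sum_apply, Matrix.mul_apply]
  · simp [dualAdj, Matrix.sum_apply, hab]

theorem sum_dualAdj_mul_mul_dualAdj (j : ℕ) (M : Matrix X X ℂ) :
    ∑ z, B.dualAdj j z * M * B.dualAdj j z = B.idem j ⊙ M := by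
  ext a b
  rw [hadamard_apply, ← idem_mul_self, Matrix.mul_apply, sum_mul, Matrix.sum_apply]
  refine sum_congr rfl fun z _ => ?_
  rw [dualAdj, mul_diagonal, diagonal_mul, B.idem_comm j a z]
  ring

theorem mul_idem_eq_zero_of_kreinSum_ne_zero {M : Matrix X X ℂ} {j k l : ℕ}
    (hM : ∀ y, M * B.dualAdj j y * B.idem k = 0) (h : B.kreinSum j k l ≠ 0) :
    M * B.idem l = 0 := by
  refine (smul_eq_zero.mp ?_).resolve_left (mt B.kreinCoeff_eq_zero_iff.mp h)
  calc B.kreinCoeff j k l • (M * B.idem l)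
      = M * (∑ y, B.dualAdj j y * B.idem k * B.dualAdj j y) * B.idem l := by
        rw [sum_dualAdj_mul_mul_dualAdj, Matrix.mul_assoc, hadamard_mul_idem, mul_smul_comm]
    _ = ∑ y, M * B.dualAdj j y * B.idem k * B.dualAdj j y * B.idem l := by
        simp only [Matrix.mul_sum, Matrix.sum_mul, Matrix.mul_assoc]
    _ = 0 := by simp only [hM, Matrix.zero_mul, sum_const_zero]

/-- The block `E_i D_j(x) E_k` of the dual adjacency matrix `D_j(x)`; it vanishes for all `x`
exactly when the Krein parameter of `i`, `j`, `k` does. -/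
noncomputable def block (i j k : ℕ) (x : X) : Matrix X X ℂ :=
  B.idem i * B.dualAdj j x * B.idem k

theorem block_apply (i j k : ℕ) (z x y : X) :
    B.block i j k z x y = ∑ b, B.idem i x b * B.idem j z b * B.idem k b y := by
  rw [block, Matrix.mul_apply]
  simp only [dualAdj, mul_diagonal]

theorem block_transpose (i j k : ℕ) (x : X) : (B.block i j k x)ᵀ = B.block k j i x := by
  simp only [block, transpose_mul, idem_transpose, dualAdj_transpose, Matrix.mul_assoc]

theorem block_conjTranspose (i j k : ℕ) (x : X) : (B.block i j k x)ᴴ = B.block k j i x := by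
  simp only [block, conjTranspose_mul, idem_conjTranspose, dualAdj_conjTranspose, Matrix.mul_assoc]

theorem idem_mul_block (i j k : ℕ) (x : X) : B.idem i * B.block i j k x = B.block i j k x := by
  simp only [block, ← Matrix.mul_assoc, idem_mul_self]

theorem block_mul_idem (i j k : ℕ) (x : X) : B.block i j k x * B.idem k = B.block i j k x := by
  simp only [block, Matrix.mul_assoc, idem_mul_self]

theorem block_mul_block (i j l j' k : ℕ) (x y : X) :
    B.block i j l x * B.block l j' k y =
      B.idem i * B.dualAdj j x * B.idem l * B.dualAdj j' y * B.idem k := by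
  rw [← block_mul_idem, Matrix.mul_assoc, idem_mul_block]
  simp only [block, ← Matrix.mul_assoc]
  simp only [Matrix.mul_assoc, idem_mul_self]

theorem sum_smul_block (i j k : ℕ) (x : X) :
    ∑ z, B.idem j x z • B.block i j k z = B.block i j k x := by
  conv_rhs => rw [block, ← sum_smul_dualAdj]
  simp only [block, Matrix.mul_sum, Matrix.sum_mul, mul_smul_comm, smul_mul_assoc]

theorem sum_block_mul_block (i j l k : ℕ) :
    ∑ z, B.block i j l z * B.block l j k z = B.kreinCoeff j l k • (B.idem i * B.idem k) := by
  rw [← mul_smul_comm, ← hadamard_mul_idem, ← sum_dualAdj_mul_mul_dualAdj]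
  simp only [block_mul_block, Matrix.mul_sum, Matrix.sum_mul, Matrix.mul_assoc]

theorem kreinSum_eq_zero_iff_block {i j k : ℕ} :
    B.kreinSum i j k = 0 ↔ ∀ x, B.block i j k x = 0 := by
  have hsum : ∑ x, (B.block i j k x * (B.block i j k x)ᴴ).trace = B.kreinSum i j k := by
    simp only [block_conjTranspose, ← trace_sum, sum_block_mul_block, idem_mul_self, kreinCoeff,
      B.kreinSum_rotate j, trace_smul, smul_eq_mul]
    rcases le_or_gt i d with hi | hi
    · exact div_mul_cancel₀ _ (B.trace_idem_ne_zero hi)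
    · simp [B.kreinSum_eq_zero_of_lt hi]
  rw [← hsum, sum_eq_zero_iff_of_nonneg fun x _ =>
    (posSemidef_self_mul_conjTranspose (B.block i j k x)).trace_nonneg]
  simp [trace_mul_conjTranspose_self_eq_zero_iff]

theorem block_eq_zero {i j k : ℕ} (h : B.kreinSum i j k = 0) (x : X) : B.block i j k x = 0 :=
  B.kreinSum_eq_zero_iff_block.mp h x

/-- The block `E_i D_j(x) D_j(y) E_k` of a product of two dual adjacency matrices. -/
noncomputable def pairBlock (i j k : ℕ) (x y : X) : Matrix X X ℂ :=
  B.idem i * (B.dualAdj j x * B.dualAdj j y) * B.idem k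

theorem pairBlock_comm (i j k : ℕ) (x y : X) : B.pairBlock i j k x y = B.pairBlock i j k y x := by
  simp only [pairBlock, (B.dualAdj_commute j j x y).eq]

theorem pairBlock_eq_sum (i j k : ℕ) (x y : X) :
    B.pairBlock i j k x y = ∑ l ∈ range (d + 1), B.block i j l x * B.block l j k y := by
  rw [pairBlock, ← Matrix.mul_one (B.dualAdj j x), ← B.sum_idem]
  simp only [block_mul_block, Matrix.mul_sum, Matrix.sum_mul, Matrix.mul_assoc]

theorem pairBlock_eq_sum_of_forall_notMem {i j k : ℕ} {s : Finset ℕ}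
    (h : ∀ l ∉ s, B.kreinSum i j l = 0 ∨ B.kreinSum l j k = 0) (x y : X) :
    B.pairBlock i j k x y = ∑ l ∈ s, B.block i j l x * B.block l j k y := by
  rw [pairBlock_eq_sum]
  refine (sum_subset (subset_union_left (s₂ := s)) fun l _ hl => ?_).trans
    (sum_subset subset_union_right fun l _ hl => ?_).symm
  · simp [block, B.idem_of_lt (show d < l by simpa using hl)]
  · rcases h l hl with h | h <;> simp [B.block_eq_zero h]

theorem diagonal_block_apply (i l j : ℕ) (x y : X) :
    diagonal (fun a => B.block i l j a x y) =
      ∑ b, (B.idem i x b * B.idem j b y) • B.dualAdj l b := by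
  ext a a'
  rcases eq_or_ne a a' with rfl | ha
  · simp only [block_apply, dualAdj, Matrix.sum_apply, Matrix.smul_apply, diagonal_apply_eq,
      smul_eq_mul, B.idem_comm l a, mul_right_comm]
  · simp [dualAdj, Matrix.sum_apply, ha]

theorem dualAdj_mul_dualAdj (i j : ℕ) (x y : X) :
    B.dualAdj i x * B.dualAdj j y =
      ∑ l ∈ range (d + 1), diagonal fun a => B.block i l j a x y := by
  ext a a'
  rcases eq_or_ne a a' with rfl | ha
  · have hsum : ∀ b, ∑ l ∈ range (d + 1), B.idem l a b = (1 : Matrix X X ℂ) a b := fun b => by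
      rw [← B.sum_idem, Matrix.sum_apply]
    simp only [Matrix.sum_apply, diagonal_apply_eq, block_apply]
    rw [sum_comm]
    simp [← sum_mul, ← mul_sum, hsum, Matrix.one_apply, dualAdj, B.idem_comm j a y]
  · simp [dualAdj, Matrix.sum_apply, ha]

theorem pairBlock_eq_smul {i j k : ℕ}
    (h : ∀ l ≠ 0, B.kreinSum j l j = 0 ∨ B.kreinSum i l k = 0) (x y : X) :
    B.pairBlock i j k x y =
      ((Fintype.card X : ℂ)⁻¹ * B.idem j x y) • (B.idem i * B.idem k) := by
  rw [pairBlock, dualAdj_mul_dualAdj, Matrix.mul_sum, Matrix.sum_mul, sum_eq_single 0]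
  · have hzero : ∀ a, B.block j 0 j a x y = (Fintype.card X : ℂ)⁻¹ * B.idem j x y := fun a => by
      simp [block, dualAdj_zero, idem_mul_self]
    simp only [hzero, ← smul_one_eq_diagonal, mul_smul_comm, smul_mul_assoc, Matrix.mul_one]
  · intro l _ hl
    rcases h l hl with h | h
    · simp [B.block_eq_zero h]
    · rw [diagonal_block_apply]
      simp only [Matrix.mul_sum, Matrix.sum_mul, mul_smul_comm, smul_mul_assoc]
      exact sum_eq_zero fun b _ => smul_eq_zero_of_right _ (B.block_eq_zero h b)
  · simp

/-- The matrix obtained by applying a polynomial to every entry of `|X| E_1`. -/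
noncomputable def polyMat (f : Polynomial ℂ) : Matrix X X ℂ :=
  ∑ k, f.eval (B.dualEigenvalue k) • S.A k

theorem polyMat_apply (f : Polynomial ℂ) {k : Fin (d + 1)} {x y : X} (h : (x, y) ∈ S.R k) :
    B.polyMat f x y = f.eval (B.dualEigenvalue k) :=
  S.sum_A_apply _ h

theorem polyMat_zero : B.polyMat 0 = 0 := by simp [polyMat]

theorem polyMat_add (f g : Polynomial ℂ) : B.polyMat (f + g) = B.polyMat f + B.polyMat g := by
  simp [polyMat, add_smul, sum_add_distrib]

theorem polyMat_smul (c : ℂ) (f : Polynomial ℂ) : B.polyMat (c • f) = c • B.polyMat f := by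
  simp [polyMat, smul_sum, smul_smul]

theorem polyMat_mul (f g : Polynomial ℂ) : B.polyMat (f * g) = B.polyMat f ⊙ B.polyMat g := by
  ext x y
  obtain ⟨k, hk⟩ := S.exists_mem x y
  simp only [hadamard_apply, B.polyMat_apply _ hk, Polynomial.eval_mul]

variable {B}

namespace IsQPolynomial

theorem exists_polyMat_eq_smul_idem (hQ : B.IsQPolynomial) {i : ℕ} (hi : i ≤ d) :
    ∃ v : Polynomial ℂ, v.degree = i ∧ B.polyMat v = (Fintype.card X : ℂ) • B.idem i := by
  obtain ⟨v, hdeg, hv⟩ := hQ ⟨i, Nat.lt_succ_of_le hi⟩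
  refine ⟨v, hdeg, ?_⟩
  rw [← Fin.val_mk (Nat.lt_succ_of_le hi), idem_val, E_eq_sum, smul_inv_smul₀ S.card_ne_zero]
  exact sum_congr rfl fun k _ => congrArg (· • S.A k) (hv k).symm

theorem polyMat_mul_idem_of_degree_lt (hQ : B.IsQPolynomial) {f : Polynomial ℂ} {r k : ℕ}
    (hf : f.degree < r) (hrk : r ≤ k) : B.polyMat f * B.idem k = 0 := by
  rcases lt_or_ge d k with hk | hk
  · rw [B.idem_of_lt hk, Matrix.mul_zero]
  induction r generalizing f with
  | zero =>
    have hf0 : f = 0 := by simpa using hf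
    rw [hf0, polyMat_zero, Matrix.zero_mul]
  | succ r ih =>
    obtain ⟨v, hdeg, hv⟩ := hQ.exists_polyMat_eq_smul_idem (i := r) (by omega)
    have hf' : f.degree ≤ r := Order.le_of_lt_succ hf
    have hsub := degree_sub_smul_lt hdeg hf'
    set c := f.coeff r / v.coeff r
    rw [← sub_add_cancel f (c • v), polyMat_add, polyMat_smul, hv, Matrix.add_mul,
      ih hsub (by omega)]
    simp only [smul_mul_assoc, B.idem_mul_of_ne (show r ≠ k by omega), smul_zero, add_zero]

theorem exists_polyMat_mul_idem (hQ : B.IsQPolynomial) {k : ℕ} (hk : k ≤ d) :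
    ∃ c ≠ (0 : ℂ), ∀ f : Polynomial ℂ, f.degree ≤ k →
      B.polyMat f * B.idem k = (c * f.coeff k) • B.idem k := by
  obtain ⟨v, hdeg, hv⟩ := hQ.exists_polyMat_eq_smul_idem hk
  have hcoeff : v.coeff k ≠ 0 := Polynomial.coeff_ne_zero_of_eq_degree hdeg
  refine ⟨Fintype.card X / v.coeff k, div_ne_zero S.card_ne_zero hcoeff, fun f hf => ?_⟩
  have hsub := degree_sub_smul_lt hdeg hf
  set c := f.coeff k / v.coeff k with hc
  rw [← sub_add_cancel f (c • v), polyMat_add, polyMat_smul, hv, Matrix.add_mul,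
    hQ.polyMat_mul_idem_of_degree_lt hsub le_rfl, sub_add_cancel, zero_add, smul_mul_assoc,
    smul_mul_assoc, idem_mul_self, smul_smul, hc]
  congr 1
  ring

theorem exists_hadamard_eq_smul_polyMat (hQ : B.IsQPolynomial) {i j : ℕ} (hi : i ≤ d)
    (hj : j ≤ d) : ∃ f : Polynomial ℂ, f.degree = ((i + j : ℕ) : WithBot ℕ) ∧
      ∃ c ≠ (0 : ℂ), B.idem i ⊙ B.idem j = c • B.polyMat f := by
  obtain ⟨v, hvdeg, hv⟩ := hQ.exists_polyMat_eq_smul_idem hi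
  obtain ⟨w, hwdeg, hw⟩ := hQ.exists_polyMat_eq_smul_idem hj
  have hX := S.card_ne_zero
  refine ⟨v * w, by simp [hvdeg, hwdeg], _, mul_ne_zero (inv_ne_zero hX) (inv_ne_zero hX), ?_⟩
  rw [polyMat_mul, hv, hw, smul_hadamard, hadamard_smul, smul_smul, smul_smul]
  field_simp
  exact (one_smul ℂ _).symm

theorem le_of_kreinSum_ne_zero (hQ : B.IsQPolynomial) {i j k : ℕ} (h : B.kreinSum i j k ≠ 0) :
    k ≤ i + j := by
  by_contra! hk
  rcases lt_or_ge d i with hi | hi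
  · exact h (B.kreinSum_eq_zero_of_lt hi j k)
  rcases lt_or_ge d j with hj | hj
  · exact h (B.kreinSum_swap i j k ▸ B.kreinSum_eq_zero_of_lt hj i k)
  obtain ⟨f, hdeg, c, -, hf⟩ := hQ.exists_hadamard_eq_smul_polyMat hi hj
  have hlt : f.degree < k := hdeg ▸ Nat.cast_lt.mpr hk
  rw [kreinSum_eq_trace, hf, smul_mul_assoc, hQ.polyMat_mul_idem_of_degree_lt hlt le_rfl,
    smul_zero, trace_zero] at h
  exact h rfl

theorem kreinSum_add_ne_zero (hQ : B.IsQPolynomial) {i j : ℕ} (h : i + j ≤ d) :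
    B.kreinSum i j (i + j) ≠ 0 := by
  obtain ⟨f, hdeg, c, hc, hf⟩ :=
    hQ.exists_hadamard_eq_smul_polyMat (show i ≤ d by omega) (show j ≤ d by omega)
  obtain ⟨e, he, hmul⟩ := hQ.exists_polyMat_mul_idem h
  have hcoeff := Polynomial.coeff_ne_zero_of_eq_degree hdeg
  rw [kreinSum_eq_trace, hf, smul_mul_assoc, hmul f hdeg.le, smul_smul, trace_smul, smul_eq_mul]
  exact mul_ne_zero (mul_ne_zero hc (mul_ne_zero he hcoeff)) (B.trace_idem_ne_zero h)

theorem dualEigenvalue_injective (hQ : B.IsQPolynomial) : Function.Injective B.dualEigenvalue := by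
  intro a b hab
  obtain ⟨⟨x, y⟩, hxy⟩ := S.nonempty a
  obtain ⟨⟨x', y'⟩, hxy'⟩ := S.nonempty b
  have hE : ∀ i, B.E i x y = B.E i x' y' := fun i => by
    obtain ⟨v, -, hv⟩ := hQ i
    rw [B.E_apply hxy, B.E_apply hxy', hv, hv]
    exact congrArg (fun θ => _ * v.eval θ) hab
  have hA : S.A a x y = S.A a x' y' := by
    simp only [B.A_eq_sum a, Matrix.sum_apply, Matrix.smul_apply, hE]
  rw [S.A_apply hxy, S.A_apply hxy', if_pos rfl] at hA
  by_contra hne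
  simp [hne] at hA

theorem K_eq (hQ : B.IsQPolynomial) {j : Fin (d + 1)} (hj : j ≠ 0) :
    B.K j = -B.p j (Fin.last d) := by
  set s : Finset (Fin (d + 1)) := {k | k ≠ 0 ∧ k ≠ j} with hs
  set f : Polynomial ℂ := Lagrange.nodal s B.dualEigenvalue with hf
  have hdeg : f.degree < d := by
    have hs' : s = (univ.erase 0).erase j := by ext; simp [hs, and_comm]
    have hj0 : 0 < (j : ℕ) := Fin.pos_iff_ne_zero.mpr hj
    rw [hf, Lagrange.degree_nodal, hs', card_erase_of_mem (by simpa using hj),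
      card_erase_of_mem (mem_univ _), card_univ, Fintype.card_fin]
    exact Nat.cast_lt.mpr (by omega)
  have hmat : B.polyMat f =
      f.eval (B.dualEigenvalue 0) • S.A 0 + f.eval (B.dualEigenvalue j) • S.A j := by
    refine sum_eq_add 0 j hj.symm (fun k _ hk => ?_) (by simp) (by simp)
    rw [Lagrange.eval_nodal_at_node (by simpa [hs] using hk), zero_smul]
  have hzero :
      f.eval (B.dualEigenvalue 0) + f.eval (B.dualEigenvalue j) * B.p j (Fin.last d) = 0 := by
    have h := hQ.polyMat_mul_idem_of_degree_lt hdeg le_rfl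
    have hlast : B.idem d = B.E (Fin.last d) := B.idem_val (Fin.last d)
    rw [hmat, hlast, Matrix.add_mul, S.A_zero, smul_mul_assoc, smul_mul_assoc, Matrix.one_mul,
      A_mul_E, smul_smul, ← add_smul] at h
    exact (smul_eq_zero.mp h).resolve_right (B.E_ne_zero _)
  have hne : f.eval (B.dualEigenvalue j) ≠ 0 :=
    Lagrange.eval_nodal_not_at_node fun k hk =>
      hQ.dualEigenvalue_injective.ne (mem_filter.mp hk).2.2.symm
  rw [K, prod_div_distrib, ← Lagrange.eval_nodal, ← Lagrange.eval_nodal, div_eq_iff hne]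
  linear_combination hzero

end IsQPolynomial

variable (B)

theorem sum_smul_pairBlock (i j k : ℕ) (x : X) :
    ∑ z, B.idem j x z • B.pairBlock i j k z z = B.kreinCoeff j j j • B.block i j k x := by
  have hsum : ∑ z, B.idem j x z • (B.dualAdj j z * B.dualAdj j z) =
      B.kreinCoeff j j j • B.dualAdj j x := by
    ext a b
    rcases eq_or_ne a b with rfl | hab
    · have h := congrFun₂ (B.hadamard_mul_idem j j j) a x
      simp only [Matrix.mul_apply, hadamard_apply, Matrix.smul_apply] at h
      simp only [dualAdj, diagonal_mul_diagonal, Matrix.sum_apply, Matrix.smul_apply,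
        diagonal_apply_eq, B.idem_comm j x, ← h, smul_eq_mul]
      exact sum_congr rfl fun z _ => by rw [B.idem_comm j z a]; ring
    · simp [dualAdj, Matrix.sum_apply, hab]
  rw [block, ← smul_mul_assoc, ← mul_smul_comm, ← hsum]
  simp only [pairBlock, Matrix.mul_sum, Matrix.sum_mul, mul_smul_comm, smul_mul_assoc]

variable {B}

namespace IsQPolynomial

theorem kreinSum_eq_zero (hQ : B.IsQPolynomial) {i j k : ℕ}
    (h : i + j < k ∨ j + k < i ∨ k + i < j) : B.kreinSum i j k = 0 := by
  by_contra hne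
  have h₁ := hQ.le_of_kreinSum_ne_zero hne
  rw [kreinSum_rotate] at hne
  have h₂ := hQ.le_of_kreinSum_ne_zero hne
  rw [kreinSum_rotate] at hne
  have h₃ := hQ.le_of_kreinSum_ne_zero hne
  omega

theorem kreinSum_ne_zero (hQ : B.IsQPolynomial) {i j k : ℕ} (hi : i ≤ d) (hj : j ≤ d) (hk : k ≤ d)
    (h : i + j = k ∨ j + k = i ∨ k + i = j) : B.kreinSum i j k ≠ 0 := by
  rcases h with rfl | rfl | rfl
  · exact hQ.kreinSum_add_ne_zero hk
  · rw [kreinSum_rotate, kreinSum_rotate]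
    exact hQ.kreinSum_add_ne_zero hi
  · rw [kreinSum_rotate]
    exact hQ.kreinSum_add_ne_zero hj

theorem pairBlock_add_two (hQ : B.IsQPolynomial) (r : ℕ) (x y : X) :
    B.pairBlock (r + 2) 1 r x y = B.block (r + 2) 1 (r + 1) x * B.block (r + 1) 1 r y := by
  rw [B.pairBlock_eq_sum_of_forall_notMem (s := {r + 1}) (fun l hl => ?_), sum_singleton]
  have hne : l ≠ r + 1 := by simpa using hl
  rcases lt_or_ge l (r + 1) with hlt | hge
  · exact Or.inl (hQ.kreinSum_eq_zero (by omega))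
  · exact Or.inr (hQ.kreinSum_eq_zero (by omega))

theorem pairBlock_add_one (hQ : B.IsQPolynomial) {r : ℕ} (h : B.kreinSum 1 r r = 0) (x y : X) :
    B.pairBlock (r + 1) 1 r x y = B.block (r + 1) 1 (r + 1) x * B.block (r + 1) 1 r y := by
  rw [B.pairBlock_eq_sum_of_forall_notMem (s := {r + 1}) (fun l hl => ?_), sum_singleton]
  have hne : l ≠ r + 1 := by simpa using hl
  rcases eq_or_ne l r with rfl | hl'
  · exact Or.inr (B.kreinSum_swap _ _ _ ▸ h)
  rcases lt_or_ge l r with hlt | hge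
  · exact Or.inl (hQ.kreinSum_eq_zero (by omega))
  · exact Or.inr (hQ.kreinSum_eq_zero (by omega))

theorem kreinSum_one_one_one_eq_zero (hQ : B.IsQPolynomial) {r : ℕ} (hr : r + 2 ≤ d)
    (h : B.kreinSum 1 (r + 1) (r + 1) = 0) : B.kreinSum 1 1 1 = 0 := by
  by_contra h111
  have hpair₁ := hQ.pairBlock_add_one h
  have hpair₂ := hQ.pairBlock_add_two r
  have hterm : ∀ y z, B.pairBlock (r + 2) 1 (r + 1) z z * B.block (r + 1) 1 r y =
      B.block (r + 2) 1 (r + 2) y * B.pairBlock (r + 2) 1 r z z := fun y z => by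
    calc _ = B.block (r + 2) 1 (r + 2) z * B.pairBlock (r + 2) 1 r z y := by
            rw [hpair₁, hpair₂, Matrix.mul_assoc]
      _ = B.pairBlock (r + 2) 1 (r + 1) z y * B.block (r + 1) 1 r z := by
            rw [pairBlock_comm, hpair₁, hpair₂, Matrix.mul_assoc]
      _ = _ := by rw [pairBlock_comm, hpair₁, hpair₂, Matrix.mul_assoc]
  have hzero : ∀ x y, B.block (r + 2) 1 (r + 1) x * B.block (r + 1) 1 r y = 0 := fun x y => by
    refine (smul_eq_zero.mp ?_).resolve_left (mt B.kreinCoeff_eq_zero_iff.mp h111)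
    have hfar : B.kreinSum (r + 2) 1 r = 0 := hQ.kreinSum_eq_zero (by omega)
    rw [← smul_mul_assoc, ← sum_smul_pairBlock, Matrix.sum_mul]
    simp only [smul_mul_assoc, hterm, ← mul_smul_comm, ← Matrix.mul_sum]
    rw [sum_smul_pairBlock, B.block_eq_zero hfar, smul_zero, Matrix.mul_zero]
  have hnear : B.kreinSum (r + 2) 1 (r + 1) ≠ 0 :=
    hQ.kreinSum_ne_zero (by omega) (by omega) (by omega) (by omega)
  refine hnear (B.kreinSum_eq_zero_iff_block.mpr fun x => ?_)
  rw [← block_mul_idem]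
  refine B.mul_idem_eq_zero_of_kreinSum_ne_zero (j := 1) (k := r) (fun y => ?_)
    (hQ.kreinSum_ne_zero (by omega) (by omega) (by omega) (by omega))
  rw [← hzero x y, block_mul_block, block]

theorem pairBlock_eq_smul_of_one_two (hQ : B.IsQPolynomial) {i k : ℕ} (h₁ : B.kreinSum 1 1 1 = 0)
    (h₂ : B.kreinSum i 2 k = 0) (x y : X) :
    B.pairBlock i 1 k x y =
      ((Fintype.card X : ℂ)⁻¹ * B.idem 1 x y) • (B.idem i * B.idem k) := by
  refine B.pairBlock_eq_smul (fun l hl => ?_) x y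
  obtain rfl | rfl | hl : l = 1 ∨ l = 2 ∨ 2 < l := by omega
  · exact Or.inl h₁
  · exact Or.inr h₂
  · exact Or.inl (hQ.kreinSum_eq_zero (by omega))

theorem kreinSum_two_two_three_ne_zero (hQ : B.IsQPolynomial) (hd : 3 ≤ d)
    (h₁ : B.kreinSum 1 1 1 = 0) (h₂ : B.kreinSum 1 2 2 ≠ 0) : B.kreinSum 2 2 3 ≠ 0 := by
  intro h₃
  have hpair : ∀ x y, B.idem 3 * B.dualAdj 1 x * B.dualAdj 1 y * B.idem 2 = 0 := fun x y => by
    have h := hQ.pairBlock_eq_smul_of_one_two h₁ (B.kreinSum_rotate 2 2 3 ▸ h₃) x y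
    rwa [B.idem_mul_of_ne (by omega), smul_zero, pairBlock, ← Matrix.mul_assoc] at h
  have hnear : B.kreinSum 3 1 2 ≠ 0 :=
    hQ.kreinSum_ne_zero (by omega) (by omega) (by omega) (by omega)
  exact hnear (B.kreinSum_eq_zero_iff_block.mpr fun x =>
    B.mul_idem_eq_zero_of_kreinSum_ne_zero (hpair x) h₂)

end IsQPolynomial

variable (B)

/-- `|X|` times `E_i D_1(x) E_l D_1(y) E_i`: the product of two dual adjacency matrices, restricted
to the `i`-th eigenspace and factored through the `l`-th one. -/
noncomputable def returnBlock (i l : ℕ) (x y : X) : Matrix X X ℂ :=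
  (Fintype.card X : ℂ) • (B.block i 1 l x * B.block l 1 i y)

theorem idem_mul_returnBlock (i l : ℕ) (x y : X) :
    B.idem i * B.returnBlock i l x y = B.returnBlock i l x y := by
  rw [returnBlock, mul_smul_comm, ← Matrix.mul_assoc, idem_mul_block]

theorem returnBlock_mul_idem (i l : ℕ) (x y : X) :
    B.returnBlock i l x y * B.idem i = B.returnBlock i l x y := by
  rw [returnBlock, smul_mul_assoc, Matrix.mul_assoc, block_mul_idem]

theorem returnBlock_transpose (i l : ℕ) (x y : X) :
    (B.returnBlock i l x y)ᵀ = B.returnBlock i l y x := by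
  simp only [returnBlock, transpose_smul, transpose_mul, block_transpose]

theorem sum_smul_returnBlock_left (i l : ℕ) (x y : X) :
    ∑ v, B.idem 1 x v • B.returnBlock i l v y = B.returnBlock i l x y := by
  simp only [returnBlock, smul_comm _ (Fintype.card X : ℂ), ← smul_mul_assoc, ← smul_sum,
    ← Matrix.sum_mul, sum_smul_block]

theorem sum_smul_returnBlock_right (i l : ℕ) (x y : X) :
    ∑ v, B.idem 1 y v • B.returnBlock i l x v = B.returnBlock i l x y := by
  simp only [returnBlock, smul_comm _ (Fintype.card X : ℂ), ← mul_smul_comm, ← smul_sum,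
    ← Matrix.mul_sum, sum_smul_block]

theorem sum_returnBlock_self (i l : ℕ) :
    ∑ v, B.returnBlock i l v v = (Fintype.card X * B.kreinCoeff 1 l i) • B.idem i := by
  simp only [returnBlock, ← smul_sum, sum_block_mul_block, idem_mul_self, smul_smul]

theorem sum_returnBlock_mul_returnBlock {i l l' : ℕ} (h : l ≠ l') (w z : X) :
    ∑ u, B.returnBlock i l w u * B.returnBlock i l' u z = 0 := by
  have hsum : ∑ u, B.block l 1 i u * B.block i 1 l' u = 0 := by
    rw [sum_block_mul_block, B.idem_mul_of_ne h, smul_zero]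
  calc ∑ u, B.returnBlock i l w u * B.returnBlock i l' u z
      = (Fintype.card X : ℂ) • (Fintype.card X : ℂ) • (B.block i 1 l w *
          (∑ u, B.block l 1 i u * B.block i 1 l' u) * B.block l' 1 i z) := by
        simp only [returnBlock, smul_mul_assoc, mul_smul_comm, smul_sum, Matrix.mul_sum,
          Matrix.sum_mul, Matrix.mul_assoc]
    _ = 0 := by rw [hsum, Matrix.mul_zero, Matrix.zero_mul, smul_zero, smul_zero]

/-- The exchange relation: `(E_1(w, v) E_i - U(w, v)) U(u, z)` is symmetric in `u` and `v`, where
`U = returnBlock i l`. -/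
def ReturnExchange (i l : ℕ) : Prop :=
  ∀ w v u z, B.idem 1 w v • B.returnBlock i l u z - B.returnBlock i l w v * B.returnBlock i l u z =
    B.idem 1 w u • B.returnBlock i l v z - B.returnBlock i l w u * B.returnBlock i l v z

variable {B}

namespace ReturnExchange

variable {i l : ℕ}

theorem sum_mul_left (h : B.ReturnExchange i l) (u z : X) :
    ∑ v, B.returnBlock i l v u * B.returnBlock i l v z =
      (1 - (B.idem 1).trace + Fintype.card X * B.kreinCoeff 1 l i) • B.returnBlock i l u z := by
  have hsum := sum_congr rfl fun v (_ : v ∈ univ) => h v v u z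
  rw [sum_sub_distrib, sum_sub_distrib, ← sum_smul, ← Matrix.sum_mul, sum_returnBlock_self,
    smul_mul_assoc, idem_mul_returnBlock] at hsum
  simp only [B.idem_comm 1 _ u] at hsum
  rw [sum_smul_returnBlock_left, show ∑ v, B.idem 1 v v = (B.idem 1).trace from rfl] at hsum
  linear_combination (norm := module) hsum

theorem sum_mul_right (h : B.ReturnExchange i l) (w v : X) :
    ∑ u, B.returnBlock i l w u * B.returnBlock i l v u =
      (1 - (B.idem 1).trace + Fintype.card X * B.kreinCoeff 1 l i) • B.returnBlock i l w v := by
  have hsum := congrArg transpose (h.sum_mul_left v w)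
  simpa only [transpose_sum, transpose_mul, transpose_smul, returnBlock_transpose] using hsum

theorem smul_idem_eq_add (h : B.ReturnExchange i l) (w v : X) :
    (Fintype.card X * B.kreinCoeff 1 l i * B.idem 1 w v) • B.idem i =
      B.returnBlock i l v w + ((B.idem 1).trace - 1) • B.returnBlock i l w v := by
  have hsum := sum_congr rfl fun u (_ : u ∈ univ) => h w v u u
  rw [sum_sub_distrib, sum_sub_distrib, h.sum_mul_right, ← smul_sum, ← Matrix.mul_sum,
    sum_returnBlock_self, mul_smul_comm, returnBlock_mul_idem, sum_smul_returnBlock_right] at hsum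
  linear_combination (norm := module) hsum

theorem trace_smul_returnBlock (h : B.ReturnExchange i l) (hm : (B.idem 1).trace ≠ 2) (w v : X) :
    (B.idem 1).trace • B.returnBlock i l w v =
      (Fintype.card X * B.kreinCoeff 1 l i * B.idem 1 w v) • B.idem i := by
  have hwv := h.smul_idem_eq_add w v
  have hvw := h.smul_idem_eq_add v w
  rw [B.idem_comm 1 v w] at hvw
  have hsymm : B.returnBlock i l w v = B.returnBlock i l v w := by
    have hdiff : ((B.idem 1).trace - 2) •
        (B.returnBlock i l w v - B.returnBlock i l v w) = 0 := by
      linear_combination (norm := module) hvw - hwv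
    exact sub_eq_zero.mp ((smul_eq_zero.mp hdiff).resolve_left (sub_ne_zero.mpr hm))
  rw [hwv, ← hsymm]
  module

end ReturnExchange

namespace IsQPolynomial

theorem returnBlock_add_returnBlock (hQ : B.IsQPolynomial) {r : ℕ} (h₁ : B.kreinSum 1 1 1 = 0)
    (hr₁ : B.kreinSum 1 (r + 1) (r + 1) = 0) (hr₂ : B.kreinSum 2 (r + 1) (r + 1) = 0) (x y : X) :
    B.returnBlock (r + 1) r x y + B.returnBlock (r + 1) (r + 2) x y =
      B.idem 1 x y • B.idem (r + 1) := by
  have hpair : B.pairBlock (r + 1) 1 (r + 1) x y =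
      B.block (r + 1) 1 r x * B.block r 1 (r + 1) y +
        B.block (r + 1) 1 (r + 2) x * B.block (r + 2) 1 (r + 1) y := by
    rw [B.pairBlock_eq_sum_of_forall_notMem (s := {r, r + 2}) (fun l hl => ?_),
      sum_pair (by omega)]
    simp only [mem_insert, mem_singleton, not_or] at hl
    rcases eq_or_ne l (r + 1) with rfl | hne
    · exact Or.inl (B.kreinSum_swap _ _ _ ▸ hr₁)
    · exact Or.inl (hQ.kreinSum_eq_zero (by omega))
  rw [hQ.pairBlock_eq_smul_of_one_two h₁ (B.kreinSum_swap _ _ _ ▸ hr₂), idem_mul_self] at hpair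
  rw [returnBlock, returnBlock, ← smul_add, ← hpair, smul_smul,
    mul_inv_cancel_left₀ S.card_ne_zero]

theorem returnExchange (hQ : B.IsQPolynomial) {r : ℕ} (h₁ : B.kreinSum 1 1 1 = 0)
    (hr₁ : B.kreinSum 1 (r + 1) (r + 1) = 0) (hr₂ : B.kreinSum 2 (r + 1) (r + 1) = 0) :
    B.ReturnExchange (r + 1) r := by
  have hprod : ∀ w v u z, B.returnBlock (r + 1) (r + 2) w v * B.returnBlock (r + 1) r u z =
      (Fintype.card X : ℂ) • (Fintype.card X : ℂ) • (B.block (r + 1) 1 (r + 2) w *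
        B.pairBlock (r + 2) 1 r v u * B.block r 1 (r + 1) z) := fun w v u z => by
    simp only [returnBlock, smul_mul_assoc, mul_smul_comm, Matrix.mul_assoc, hQ.pairBlock_add_two]
  intro w v u z
  have hswap : B.returnBlock (r + 1) (r + 2) w v * B.returnBlock (r + 1) r u z =
      B.returnBlock (r + 1) (r + 2) w u * B.returnBlock (r + 1) r v z := by
    rw [hprod, hprod, pairBlock_comm]
  have hadd : ∀ x y, B.returnBlock (r + 1) (r + 2) x y =
      B.idem 1 x y • B.idem (r + 1) - B.returnBlock (r + 1) r x y := fun x y =>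
    eq_sub_of_add_eq' (hQ.returnBlock_add_returnBlock h₁ hr₁ hr₂ x y)
  simpa only [hadd, Matrix.sub_mul, smul_mul_assoc, idem_mul_returnBlock] using hswap

theorem kreinSum_two_ne_zero (hQ : B.IsQPolynomial) (hm : (B.idem 1).trace ≠ 2) {r : ℕ}
    (hr : r + 2 ≤ d) (h₁ : B.kreinSum 1 1 1 = 0) (hr₁ : B.kreinSum 1 (r + 1) (r + 1) = 0) :
    B.kreinSum 2 (r + 1) (r + 1) ≠ 0 := by
  intro hr₂
  have hcoeff : ∀ l ≤ d, l = r ∨ l = r + 2 → Fintype.card X * B.kreinCoeff 1 l (r + 1) ≠ 0 :=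
    fun l hl hlr => mul_ne_zero S.card_ne_zero <| mt B.kreinCoeff_eq_zero_iff.mp <|
      hQ.kreinSum_ne_zero (by omega) hl (by omega) (by omega)
  have hU := (hQ.returnExchange h₁ hr₁ hr₂).trace_smul_returnBlock hm
  have hY : ∀ w z, B.returnBlock (r + 1) (r + 2) w z = 0 := fun w z => by
    have hzero : (B.idem 1).trace •
        ∑ u, B.returnBlock (r + 1) r w u * B.returnBlock (r + 1) (r + 2) u z = 0 := by
      rw [B.sum_returnBlock_mul_returnBlock (by omega), smul_zero]
    simp only [smul_sum, ← smul_mul_assoc, hU, mul_smul] at hzero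
    simp only [smul_mul_assoc, idem_mul_returnBlock, ← smul_sum, sum_smul_returnBlock_left]
      at hzero
    rw [smul_smul] at hzero
    exact (smul_eq_zero.mp hzero).resolve_left (hcoeff r (by omega) (Or.inl rfl))
  have hself := B.sum_returnBlock_self (r + 1) (r + 2)
  simp only [hY, sum_const_zero] at hself
  exact smul_ne_zero (hcoeff (r + 2) hr (Or.inr rfl)) (B.idem_ne_zero (by omega)) hself.symm

end IsQPolynomial

end PrimitiveIdempotents

end SymmAssocScheme

/-- The properties of the relation `q_{ij}^k ≠ 0` on `{0, …, d}`, for a `Q`-polynomial scheme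
with `m_1 ≠ 2`, that determine how field automorphisms may permute the idempotents. -/
structure IsKreinPattern (d : ℕ) (N : ℕ → ℕ → ℕ → Prop) : Prop where
  le : ∀ {i j k}, N i j k → i ≤ d
  swap : ∀ {i j k}, N i j k → N j i k
  rotate : ∀ {i j k}, N i j k → N k i j
  le_add : ∀ {i j k}, N i j k → k ≤ i + j
  add : ∀ {i j}, i + j ≤ d → N i j (i + j)
  not_one : ∀ {i}, 1 ≤ i → i < d → ¬N 1 i i → ¬N 1 1 1
  two : ∀ {i}, 1 ≤ i → i < d → ¬N 1 1 1 → ¬N 1 i i → N 2 i i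
  three : 3 ≤ d → ¬N 1 1 1 → N 1 2 2 → N 2 2 3

namespace IsKreinPattern

variable {d : ℕ} {N : ℕ → ℕ → ℕ → Prop}

theorem triangle (hN : IsKreinPattern d N) {i j k : ℕ} (h : N i j k) :
    k ≤ i + j ∧ i ≤ j + k ∧ j ≤ k + i :=
  ⟨hN.le_add h, hN.le_add (hN.rotate (hN.rotate h)), hN.le_add (hN.rotate h)⟩

theorem of_add (hN : IsKreinPattern d N) {i j k : ℕ} (hi : i ≤ d) (hj : j ≤ d) (hk : k ≤ d)
    (h : i + j = k ∨ j + k = i ∨ k + i = j) : N i j k := by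
  rcases h with rfl | rfl | rfl
  · exact hN.add hk
  · exact hN.rotate (hN.add hi)
  · exact hN.rotate (hN.rotate (hN.add hj))

theorem zero_iff (hN : IsKreinPattern d N) {i : ℕ} : N 0 i i ↔ i ≤ d :=
  ⟨fun h => hN.le (hN.swap h), fun h => hN.of_add (Nat.zero_le d) h h (by omega)⟩

end IsKreinPattern

/-- A permutation preserving a Krein pattern. It acts on all of `ℕ`, so that indices can be shifted
without proofs that they stay in `{0, …, d}`. -/
structure IsKreinAut (d : ℕ) (N : ℕ → ℕ → ℕ → Prop) (π : Equiv.Perm ℕ) : Prop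
    extends IsKreinPattern d N where
  zero : π 0 = 0
  map_iff : ∀ {i j k}, N (π i) (π j) (π k) ↔ N i j k

namespace IsKreinAut

variable {d : ℕ} {N : ℕ → ℕ → ℕ → Prop} {π : Equiv.Perm ℕ}

theorem symm (h : IsKreinAut d N π) : IsKreinAut d N π.symm where
  toIsKreinPattern := h.toIsKreinPattern
  zero := by rw [Equiv.symm_apply_eq, h.zero]
  map_iff {i j k} := by simpa using (h.map_iff (i := π.symm i) (j := π.symm j) (k := π.symm k)).symm

theorem apply_le_iff (h : IsKreinAut d N π) {i : ℕ} : π i ≤ d ↔ i ≤ d := by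
  have hmap : N (π 0) (π i) (π i) ↔ N 0 i i := h.map_iff
  rwa [h.zero, h.zero_iff, h.zero_iff] at hmap

theorem apply_ne_zero (h : IsKreinAut d N π) {i : ℕ} (hi : i ≠ 0) : π i ≠ 0 :=
  fun h0 => hi (π.injective (h0.trans h.zero.symm))

/- The relation `N 1` holds between the neighbours of the path `0, 1, …, d` and, outside the
diagonal, only there. Hence `N (π 1)` describes the path `π 0, π 1, …, π d`, on which `π.symm`
is the position. -/
theorem symm_adjacent (h : IsKreinAut d N π) {x y : ℕ} (hxy : N (π 1) x y) (hne : x ≠ y) :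
    π.symm y = π.symm x + 1 ∨ π.symm x = π.symm y + 1 := by
  have hpos : N 1 (π.symm x) (π.symm y) := by simpa using h.symm.map_iff.mpr hxy
  have hdist := h.triangle hpos
  have hne' := π.symm.injective.ne hne
  omega

theorem symm_adjacent_of_add (h : IsKreinAut d N π) {x y : ℕ} (h1 : π 1 ≤ d) (hx : x ≤ d)
    (hy : y ≤ d) (hxy : π 1 + x = y ∨ x + y = π 1 ∨ y + π 1 = x) (hne : x ≠ y) :
    π.symm y = π.symm x + 1 ∨ π.symm x = π.symm y + 1 :=
  h.symm_adjacent (h.of_add h1 hx hy hxy) hne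

theorem apply_eq_self_of_apply_one (h : IsKreinAut d N π) (h1 : π 1 = 1) {i : ℕ} (hi : i ≤ d) :
    π i = i := by
  suffices hs : π.symm i = i from (π.symm_apply_eq.mp hs).symm
  induction i using Nat.strong_induction_on with
  | _ i ih =>
    match i with
    | 0 => exact h.symm.zero
    | 1 => rw [Equiv.symm_apply_eq, h1]
    | i + 2 =>
      have hi0 := ih i (by omega) (by omega)
      have hi1 := ih (i + 1) (by omega) (by omega)
      have hadj := h.symm_adjacent_of_add (x := i + 1) (y := i + 2) (by omega) (by omega) hi
        (by omega) (by omega)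
      have hne : π.symm (i + 2) ≠ π.symm i := π.symm.injective.ne (by omega)
      omega

theorem apply_last_of_apply_one_eq_two (h : IsKreinAut d N π) (hd : 3 ≤ d) (h1 : π 1 = 2) :
    π d = d := by
  have hs2 : π.symm 2 = 1 := by rw [Equiv.symm_apply_eq, h1]
  have h122 : N 1 2 2 := by
    by_contra h122
    have h111 := h.not_one (by omega) (by omega) h122
    have h222 := h.symm.map_iff.mpr (h.two (by omega) (by omega) h111 h122)
    exact h111 (by simpa only [hs2] using h222)
  have hs1 : π.symm 1 = 2 := by
    have hadj := h.symm_adjacent (x := 2) (y := 1)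
      (h1.symm ▸ h.rotate (h.rotate h122)) (by omega)
    have hpos := h.symm.apply_ne_zero one_ne_zero
    omega
  have hd3 : d = 3 := by
    by_contra hd3
    have hadj := h.symm_adjacent_of_add (x := 2) (y := 4) (by omega) (by omega) (by omega)
      (by omega) (by omega)
    have hpos := h.symm.apply_ne_zero (i := 4) (by omega)
    have hne : π.symm 4 ≠ π.symm 1 := π.symm.injective.ne (by omega)
    omega
  subst hd3
  have hle := h.apply_le_iff.mpr le_rfl
  have hpos := h.apply_ne_zero (i := 3) (by omega)
  have hne1 : π 3 ≠ π 1 := π.injective.ne (by omega)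
  have hne2 : π 3 ≠ π 2 := π.injective.ne (by omega)
  rw [Equiv.symm_apply_eq] at hs1
  omega

theorem symm_neighbours_one (h : IsKreinAut d N π) (h2 : 2 < π 1) (hd : π 1 < d) :
    (π.symm (π 1 - 1) + 1 = π.symm 1 ∧ π.symm (π 1 + 1) = π.symm 1 + 1) ∨
      (π.symm (π 1 - 1) = π.symm 1 + 1 ∧ π.symm (π 1 + 1) + 1 = π.symm 1) := by
  have hpred := h.symm_adjacent_of_add (x := 1) (y := π 1 - 1) (by omega) (by omega) (by omega)
    (by omega) (by omega)
  have hsucc := h.symm_adjacent_of_add (x := 1) (y := π 1 + 1) (by omega) (by omega) (by omega)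
    (by omega) (by omega)
  have hne : π.symm (π 1 - 1) ≠ π.symm (π 1 + 1) := π.symm.injective.ne (by omega)
  omega

/- Otherwise the vertex `1` of the path described by `N (π 1)` would have the three neighbours
`π 1 - 1`, `π 1` and `π 1 + 1`. -/
theorem not_one_apply_one (h : IsKreinAut d N π) (h2 : 2 < π 1) (hd : π 1 < d) :
    ¬N 1 (π 1) (π 1) := by
  intro hN
  have hadj := h.symm_adjacent (h.swap hN) (by omega)
  have hnbr := h.symm_neighbours_one h2 hd
  have hpred : π.symm (π 1 - 1) ≠ π.symm (π 1) := π.symm.injective.ne (by omega)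
  have hsucc : π.symm (π 1 + 1) ≠ π.symm (π 1) := π.symm.injective.ne (by omega)
  omega

theorem not_one_one_one (h : IsKreinAut d N π) (h2 : 2 < π 1) (hd : π 1 < d) : ¬N 1 1 1 :=
  h.not_one (by omega) hd (h.not_one_apply_one h2 hd)

theorem symm_two (h : IsKreinAut d N π) (h2 : 2 < π 1) (hd : π 1 < d) : π.symm 2 = 2 := by
  have h2aa : N 2 (π 1) (π 1) :=
    h.two (by omega) hd (h.not_one_one_one h2 hd) (h.not_one_apply_one h2 hd)
  have hadj := h.symm_adjacent (h.rotate (h.rotate h2aa)) (by omega)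
  have hpos := h.symm.apply_ne_zero two_ne_zero
  rw [π.symm_apply_apply] at hadj
  omega

theorem two_lt_symm_one (h : IsKreinAut d N π) (h2 : 2 < π 1) (hd : π 1 < d) :
    2 < π.symm 1 := by
  have hnbr := h.symm_neighbours_one h2 hd
  have hpred := h.symm.apply_ne_zero (i := π 1 - 1) (by omega)
  have hsucc := h.symm.apply_ne_zero (i := π 1 + 1) (by omega)
  have hne : π.symm 1 ≠ π.symm 2 := π.symm.injective.ne (by omega)
  rw [h.symm_two h2 hd] at hne
  omega

theorem symm_one_lt (h : IsKreinAut d N π) (h2 : 2 < π 1) (hd : π 1 < d) : π.symm 1 < d := by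
  have hnbr := h.symm_neighbours_one h2 hd
  have hpred := h.symm.apply_le_iff.mpr (show π 1 - 1 ≤ d by omega)
  have hsucc := h.symm.apply_le_iff.mpr (show π 1 + 1 ≤ d by omega)
  omega

theorem symm_apply_one_add_two (h : IsKreinAut d N π) (h2 : 2 < π 1) (hd : π 1 + 2 ≤ d) :
    π.symm (π 1 + 2) = 3 := by
  have hadj := h.symm_adjacent_of_add (x := 2) (y := π 1 + 2) (by omega) (by omega) (by omega)
    (by omega) (by omega)
  have hne : π.symm (π 1 + 2) ≠ π.symm (π 1) := π.symm.injective.ne (by omega)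
  rw [h.symm_two h2 (by omega)] at hadj
  rw [π.symm_apply_apply] at hne
  omega

theorem symm_apply_one_sub_two (h : IsKreinAut d N π) (h2 : 2 < π 1) (hd : π 1 < d)
    (h4 : π 1 ≠ 4) : π.symm (π 1 - 2) = 3 := by
  have hadj := h.symm_adjacent_of_add (x := 2) (y := π 1 - 2) (by omega) (by omega) (by omega)
    (by omega) (by omega)
  have hne : π.symm (π 1 - 2) ≠ π.symm (π 1) := π.symm.injective.ne (by omega)
  rw [h.symm_two h2 hd] at hadj
  rw [π.symm_apply_apply] at hne
  omega

theorem apply_one_eq_pred (h : IsKreinAut d N π) (h2 : 2 < π 1) (hd : π 1 < d) :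
    π 1 = d - 1 := by
  by_contra hlt
  have hadd := h.symm_apply_one_add_two h2 (by omega)
  have h4 : π 1 = 4 := by
    by_contra h4
    have hsub := h.symm_apply_one_sub_two h2 hd h4
    have := π.symm.injective (hadd.trans hsub.symm)
    omega
  by_cases hs4 : π.symm 1 = 4
  · have hπ4 : π 4 = 1 := by rw [← hs4, π.apply_symm_apply]
    have hπ3 : π 3 = 6 := by rw [← hadd, π.apply_symm_apply, h4]
    have h134 : N 1 3 4 := h.add (show 1 + 3 ≤ d by omega)
    have htri := h.triangle (h.map_iff.mpr h134)
    omega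
  · have hs2 := h.two_lt_symm_one h2 hd
    have hsub : π (π.symm 1 - 2) = 3 := h.symm.symm_apply_one_sub_two hs2 (h.symm_one_lt h2 hd) hs4
    have hs3 : π.symm 3 = π.symm 1 - 2 := by rw [← hsub, π.symm_apply_apply]
    have hadj := h.symm_adjacent_of_add (x := 1) (y := 3) (by omega) (by omega) (by omega)
      (by omega) (by omega)
    omega

theorem symm_last_ne_sub_two (h : IsKreinAut d N π) (h2 : 2 < π 1) (hd : π 1 < d)
    (hsub : π.symm (d - 2) = d) : π.symm d ≠ d - 2 := by
  intro hlast
  have h1 := h.apply_one_eq_pred h2 hd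
  have hs1 := h.symm.apply_one_eq_pred (h.two_lt_symm_one h2 hd) (h.symm_one_lt h2 hd)
  have hs2 := h.symm_two h2 hd
  have hd5 : d = 5 := by
    by_contra hd5
    have hN : N 2 (d - 2) (d - 4) := h.of_add (by omega) (by omega) (by omega) (by omega)
    have htri := h.triangle (h.symm.map_iff.mpr hN)
    have hle := h.symm.apply_le_iff.mpr (show d - 4 ≤ d by omega)
    have hne : π.symm (d - 4) ≠ π.symm d := π.symm.injective.ne (by omega)
    have hne1 : π.symm (d - 4) ≠ π.symm 1 := π.symm.injective.ne (by omega)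
    have hne2 : π.symm (d - 4) ≠ π.symm (d - 2) := π.symm.injective.ne (by omega)
    omega
  subst hd5
  have hs4 : π.symm 4 = 1 := by rw [Equiv.symm_apply_eq, h1]
  have h422 : N 4 2 2 := h.of_add (by omega) (by omega) (by omega) (by omega)
  have h122 : N 1 2 2 := by simpa only [hs4, hs2] using h.symm.map_iff.mpr h422
  have h223 := h.three (by omega) (h.not_one_one_one h2 hd) h122
  have htri := h.triangle (h.symm.map_iff.mpr h223)
  norm_num at hsub
  omega

theorem apply_last_of_middle (h : IsKreinAut d N π) (h2 : 2 < π 1) (hd : π 1 < d) :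
    π d = d := by
  have h1 := h.apply_one_eq_pred h2 hd
  have hs1 := h.symm.apply_one_eq_pred (h.two_lt_symm_one h2 hd) (h.symm_one_lt h2 hd)
  have hnbr := h.symm_neighbours_one h2 hd
  have hswap := h.symm_last_ne_sub_two h2 hd
  rw [h1, hs1, show d - 1 - 1 = d - 2 by omega, show d - 1 + 1 = d by omega] at hnbr
  rw [← Equiv.eq_symm_apply]
  omega

theorem apply_one_eq_last (h : IsKreinAut d N π) (hd : 1 ≤ d) (hlast : π d ≠ d) :
    π 1 = d := by
  have hle := h.apply_le_iff.mpr hd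
  have hpos := h.apply_ne_zero one_ne_zero
  have hne1 : π 1 ≠ 1 := fun h1 => hlast (h.apply_eq_self_of_apply_one h1 le_rfl)
  by_contra hne
  have hne2 : π 1 ≠ 2 := fun h2 => hlast (h.apply_last_of_apply_one_eq_two (by omega) h2)
  exact hlast (h.apply_last_of_middle (by omega) (by omega))

/-- The map fixing the even numbers and reflecting `{1, …, d}` on the odd ones. -/
def oddReflection (d i : ℕ) : ℕ :=
  if Even i then i else d + 1 - i

theorem oddReflection_of_even {i : ℕ} (hi : Even i) : oddReflection d i = i :=
  if_pos hi

theorem oddReflection_of_odd {i : ℕ} (hi : Odd i) : oddReflection d i = d + 1 - i :=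
  if_neg (Nat.not_even_iff_odd.mpr hi)

theorem sub_two_le_apply (h : IsKreinAut d N π) (h1 : π 1 = d) {x : ℕ} (hN : N 1 (π.symm 2) x) :
    d - 2 ≤ π x ∧ π x ≤ d := by
  have hmap := h.map_iff.mpr hN
  rw [h1, π.apply_symm_apply] at hmap
  have htri := h.triangle hmap
  exact ⟨by omega, h.le (h.rotate hmap)⟩

theorem symm_two_of_one_eq_last (h : IsKreinAut d N π) (hd : 6 ≤ d) (h1 : π 1 = d)
    (hs1 : π.symm 1 = d) : π.symm 2 = 2 ∨ π.symm 2 = d - 2 ∧ π (d - 3) = d - 2 := by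
  have hpred : π.symm (d - 1) = d - 1 := by
    have hadj := h.symm_adjacent_of_add (x := 1) (y := d - 1) (by omega) (by omega) (by omega)
      (by omega) (by omega)
    have hle := h.symm.apply_le_iff.mpr (show d - 1 ≤ d by omega)
    omega
  have hπd : π d = 1 := by rw [← Equiv.eq_symm_apply, hs1]
  have hπpred : π (d - 1) = d - 1 := by rw [← Equiv.eq_symm_apply, hpred]
  generalize he : π.symm 2 = e
  have hπe : π e = 2 := by rw [← he, π.apply_symm_apply]
  by_cases he2 : e = 2
  · exact .inl he2
  have hle : e ≤ d := he ▸ h.symm.apply_le_iff.mpr (by omega)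
  have hpos : e ≠ 0 := he ▸ h.symm.apply_ne_zero two_ne_zero
  have hne1 : e ≠ 1 := by rintro rfl; omega
  have hned : e ≠ d := by rintro rfl; omega
  have hnepred : e ≠ d - 1 := by rintro rfl; omega
  have hlow := h.sub_two_le_apply (x := e - 1) h1
    (h.of_add (by omega) (by omega) (by omega) (by omega))
  have hhigh := h.sub_two_le_apply (x := e + 1) h1
    (h.of_add (by omega) (by omega) (by omega) (by omega))
  have hlow1 : π (e - 1) ≠ π 1 := π.injective.ne (by omega)
  have hlowpred : π (e - 1) ≠ π (d - 1) := π.injective.ne (by omega)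
  have hhigh1 : π (e + 1) ≠ π 1 := π.injective.ne (by omega)
  have hne : π (e + 1) ≠ π (e - 1) := π.injective.ne (by omega)
  have hsucc : e + 1 = d - 1 := π.injective (by omega)
  rw [show d - 3 = e - 1 by omega]
  omega

theorem symm_two_eq_two (h : IsKreinAut d N π) (hd : 6 ≤ d) (h1 : π 1 = d)
    (hs1 : π.symm 1 = d) : π.symm 2 = 2 := by
  obtain hs2 | ⟨-, hthree⟩ := h.symm_two_of_one_eq_last hd h1 hs1
  · exact hs2
  obtain h2 | ⟨h2, -⟩ := h.symm.symm_two_of_one_eq_last hd hs1 h1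
  · rwa [Equiv.symm_apply_eq, eq_comm]
  · have := π.injective (hthree.trans h2.symm)
    omega

theorem symm_add_two_of_even (h : IsKreinAut d N π) (h2 : π.symm 2 = 2) {j : ℕ} (hj : Even j)
    (hjd : 2 * (j + 2) ≤ d)
    (ih : ∀ k < j + 2, π k = oddReflection d k ∧ π.symm k = oddReflection d k) :
    π.symm (j + 2) = j + 2 := by
  obtain rfl | hpos := Nat.eq_zero_or_pos j
  · exact h2
  obtain ⟨i, rfl⟩ : ∃ i, j = i + 2 := Nat.exists_eq_add_of_le' (by obtain ⟨c, rfl⟩ := hj; omega)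
  have hi : Even i := by simpa [Nat.even_add] using hj
  have hs0 : π.symm (i + 2) = i + 2 := by
    rw [(ih _ (by omega)).2, oddReflection_of_even hj]
  have hsub : π.symm i = i := by
    rw [(ih _ (by omega)).2, oddReflection_of_even hi]
  have hpred : π (i + 1) = d + 1 - (i + 1) := by
    rw [(ih _ (by omega)).1, oddReflection_of_odd hi.add_one]
  have hsucc : π (i + 2 + 1) = d + 1 - (i + 2 + 1) := by
    rw [(ih _ (by omega)).1, oddReflection_of_odd hj.add_one]
  have hN : N 2 (i + 2) (i + 2 + 2) := h.of_add (by omega) (by omega) (by omega) (by omega)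
  have htri := h.triangle (h.symm.map_iff.mpr hN)
  have hne0 : π.symm (i + 2 + 2) ≠ π.symm (i + 2) := π.symm.injective.ne (by omega)
  have hnesub : π.symm (i + 2 + 2) ≠ π.symm i := π.symm.injective.ne (by omega)
  have hnepred : π.symm (i + 2 + 2) ≠ i + 1 := by rw [Ne, Equiv.symm_apply_eq]; omega
  have hnesucc : π.symm (i + 2 + 2) ≠ i + 2 + 1 := by rw [Ne, Equiv.symm_apply_eq]; omega
  omega

theorem apply_add_two_of_odd (h : IsKreinAut d N π) (h1 : π 1 = d) {j : ℕ} (hj : Odd j)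
    (hjd : 2 * (j + 2) ≤ d)
    (ih : ∀ k < j + 2, π k = oddReflection d k ∧ π.symm k = oddReflection d k) :
    π (j + 2) = d + 1 - (j + 2) := by
  have hj0 : π j = d + 1 - j := by rw [(ih _ (by omega)).1, oddReflection_of_odd hj]
  have hsucc : π.symm (j + 1) = j + 1 := by
    rw [(ih _ (by omega)).2, oddReflection_of_even hj.add_one]
  have hadj := h.symm_adjacent_of_add (x := j + 1) (y := d - (j + 1)) (by omega) (by omega)
    (by omega) (by omega) (by omega)
  have hne : π.symm (d - (j + 1)) ≠ j := by rw [Ne, Equiv.symm_apply_eq]; omega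
  have hs : π.symm (d - (j + 1)) = j + 2 := by omega
  rw [← hs, π.apply_symm_apply]
  omega

theorem apply_eq_oddReflection (h : IsKreinAut d N π) (hd : 6 ≤ d) (h1 : π 1 = d)
    (hs1 : π.symm 1 = d) {i : ℕ} (hi : 2 * i ≤ d) :
    π i = oddReflection d i ∧ π.symm i = oddReflection d i := by
  have hs2 := h.symm_two_eq_two hd h1 hs1
  have h2 := h.symm.symm_two_eq_two hd hs1 h1
  induction i using Nat.strong_induction_on with
  | _ i ih =>
    match i with
    | 0 => exact ⟨h.zero, h.symm.zero⟩
    | 1 => exact ⟨h1, hs1⟩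
    | j + 2 =>
      have ih_apply k (hk : k < j + 2) := ih k hk (by omega)
      have ih_symm k (hk : k < j + 2) := (ih_apply k hk).symm
      obtain hj | hj := j.even_or_odd
      · rw [oddReflection_of_even (hj.add even_two)]
        exact ⟨h.symm.symm_add_two_of_even h2 hj hi ih_symm,
          h.symm_add_two_of_even hs2 hj hi ih_apply⟩
      · rw [oddReflection_of_odd (hj.add_even even_two)]
        exact ⟨h.apply_add_two_of_odd h1 hj hi ih_apply,
          h.symm.apply_add_two_of_odd hs1 hj hi ih_symm⟩

theorem apply_last_or_apply_odd (h : IsKreinAut d N π) :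
    π d = d ∨ ∀ t, Odd t → 2 * t ≤ d → π t = d + 1 - t := by
  refine or_iff_not_imp_left.mpr fun hlast t hodd htd => ?_
  have hd : 1 ≤ d := by have := hodd.pos; omega
  have h1 := h.apply_one_eq_last hd hlast
  have hs1 := h.symm.apply_one_eq_last hd fun hs => hlast (π.symm_apply_eq.mp hs).symm
  obtain h6 | h6 := le_or_gt 6 d
  · rw [(h.apply_eq_oddReflection h6 h1 hs1 htd).1, oddReflection_of_odd hodd]
  · obtain rfl : t = 1 := by obtain ⟨c, rfl⟩ := hodd; omega
    exact h1

end IsKreinAut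

namespace SymmAssocScheme.PrimitiveIdempotents

variable {X : Type*} [Fintype X] [DecidableEq X] {d : ℕ} {S : SymmAssocScheme X d}
  {B : S.PrimitiveIdempotents}

theorem IsQPolynomial.isKreinPattern (hQ : B.IsQPolynomial) (hm : (B.idem 1).trace ≠ 2) :
    IsKreinPattern d fun i j k => B.kreinSum i j k ≠ 0 where
  le {i j k} h := by
    by_contra! hi
    exact h (B.kreinSum_eq_zero_of_lt hi j k)
  swap {i j k} h := B.kreinSum_swap i j k ▸ h
  rotate {i j k} h := B.kreinSum_rotate i j k ▸ h
  le_add := hQ.le_of_kreinSum_ne_zero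
  add := hQ.kreinSum_add_ne_zero
  not_one {i} hi hd h := by
    obtain ⟨r, rfl⟩ := Nat.exists_eq_add_of_le' hi
    exact not_not.mpr (hQ.kreinSum_one_one_one_eq_zero (by omega) (not_not.mp h))
  two {i} hi hd h₁ h := by
    obtain ⟨r, rfl⟩ := Nat.exists_eq_add_of_le' hi
    exact hQ.kreinSum_two_ne_zero hm (by omega) (not_not.mp h₁) (not_not.mp h)
  three hd h₁ h₂ := hQ.kreinSum_two_two_three_ne_zero hd (not_not.mp h₁) h₂

theorem IsQPolynomial.isKreinAut_galoisPermNat (hQ : B.IsQPolynomial)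
    (hm : (B.idem 1).trace ≠ 2) (σ : ℂ →+* ℂ) :
    IsKreinAut d (fun i j k => B.kreinSum i j k ≠ 0) (B.galoisPermNat σ) where
  toIsKreinPattern := hQ.isKreinPattern hm
  zero := by simpa [B.galoisPerm_zero] using B.galoisPermNat_val σ 0
  map_iff {_ _ _} := by rw [kreinSum_galoisPermNat, map_ne_zero]

theorem trace_idem_one (hd : 1 ≤ d) : (B.idem 1).trace = B.m 1 := by
  obtain ⟨k, rfl⟩ := Nat.exists_eq_add_of_le' hd
  rw [B.m_eq_trace]
  exact congrArg trace (B.idem_val 1)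

theorem IsQPolynomial.galoisPerm_last_or_galoisPerm_odd (hQ : B.IsQPolynomial)
    (hm : (B.idem 1).trace ≠ 2) (σ : ℂ →+* ℂ) :
    B.galoisPerm σ (Fin.last d) = Fin.last d ∨
      ∀ t s : Fin (d + 1), Odd (t : ℕ) → 2 * (t : ℕ) ≤ d → (s : ℕ) = d + 1 - t →
        B.galoisPerm σ t = s := by
  refine (hQ.isKreinAut_galoisPermNat hm σ).apply_last_or_apply_odd.imp (fun hlast => ?_)
    fun hodd t s ht htd hs => ?_
  · exact Fin.ext ((B.galoisPermNat_val σ (Fin.last d)).symm.trans hlast)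
  · exact Fin.ext ((B.galoisPermNat_val σ t).symm.trans ((hodd t ht htd).trans hs.symm))

end SymmAssocScheme.PrimitiveIdempotents

theorem mainTheorem3 {X : Type*} [Fintype X] [DecidableEq X] {d : ℕ}
    (S : SymmAssocScheme X d) (B : S.PrimitiveIdempotents) (hQ : B.IsQPolynomial)
    (hm : 2 < (B.m 1).re)
    (ht : ∃ t s : Fin (d + 1), Odd (t : ℕ) ∧ 2 * (t : ℕ) ≤ d ∧ (s : ℕ) = d - (t : ℕ) + 1 ∧
      B.m t ≠ B.m s) :
    ∀ j : Fin (d + 1), j ≠ 0 →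
      B.K j = -B.p j (Fin.last d) ∧ ∃ n : ℤ, B.K j = (n : ℂ) := by
  intro j hj
  obtain ⟨t, s, hodd, htd, hs, hne⟩ := ht
  have hd : 1 ≤ d := by have := hodd.pos; omega
  have htrace : (B.idem 1).trace ≠ 2 := by
    rw [B.trace_idem_one hd]
    intro h
    simp [h] at hm
  have hfix : ∀ σ : ℂ ≃+* ℂ, σ (B.p j (Fin.last d)) = B.p j (Fin.last d) := fun σ => by
    obtain hlast | hreflect := hQ.galoisPerm_last_or_galoisPerm_odd htrace (σ : ℂ →+* ℂ)
    · have hp := B.p_galoisPerm (σ : ℂ →+* ℂ) j (Fin.last d)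
      rw [hlast] at hp
      exact hp.symm
    · have hts := hreflect t s hodd htd (by omega)
      exact absurd (hts ▸ (B.m_galoisPerm (σ : ℂ →+* ℂ) t).symm) hne
  obtain ⟨n, hn⟩ := exists_intCast_eq_of_isIntegral (B.isIntegral_p j (Fin.last d)) hfix
  exact ⟨hQ.K_eq hj, -n, by rw [hQ.K_eq hj, ← hn, Int.cast_neg]⟩
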